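/- **Setting.** Let $A$ be a commutative integral domain containing $\mathbb Q$ and $n\ge 2$. Put $\mathcal T_n=\{t_{i,j}\}_{1\le i<j\le n}=T_n\sqcup\mathcal T_{n-1}$ with $T_n=\{t_{i,n}\}_{1\le i<n}$. Let $A\langle\mathcal T_n\rangle$ be the algebra of noncommutative polynomials over $\mathcal T_n$, with the concatenation, the bracket $[P,Q]=PQ-QP$, the shuffle product ⧢, the pairing $\langle P|Q\rangle=\sum_w\langle P|w\rangle\langle Q|w\rangle$, and the half-shuffle $\prec$, the bilinear product with $1\prec R=0$ and $(xH)\prec R=x(H⧢R)$ for a letter $x$. For a word $w=x_1\cdots x_m$ let $\tilde w=x_m\cdots x_1$, $a(w)=(-1)^m\tilde w$, and, for $m\geq 1$, $r(w)=[x_1,[\dots,[x_{m-1},x_m]\dots]]$. Let $\mathcal Lie$ be the Lie subalgebra of $A\langle\mathcal T_n\rangle$ generated by $\mathcal T_n$ (Lie polynomials), and $\mathcal I_n$ the Lie subalgebra generated by the elements $\mathrm{ad}_{-v}t:=\mathrm{ad}_{-x_1}\circ\cdots\circ\mathrm{ad}_{-x_k}(t)$, for $v=x_1\cdots x_k\in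 T_n^*$ and $t\in\mathcal T_{n-1}$. For $L=\mathcal I_n$ or $\mathcal Lie$ let $\varphi:\mathcal U(L)\to A\langle\mathcal T_n\rangle$ be the algebra morphism extending the inclusion. For $M=\mathcal I_n$, $\mathcal U(\mathcal I_n)$ or $\mathcal U(\mathcal Lie)$, graded by the length of words through its map to $A\langle\mathcal T_n\rangle$, let $M^\vee$ be the graded dual, that is, the module of linear forms on $M$ which vanish on all elements whose components of degree $<N$ are zero, for some $N$. A polynomial $P$ defines a linear form $\langle P|\cdot\rangle$ on $M$. For a finite sequence $\ell=((v_1,t_1),\dots,(v_p,t_p))$ with $p\ge0$, $v_i\in T_n^*$, $t_i\in\mathcal T_{n-1}$, put $$b_\ell=\mathrm{ad}_{-v_1}t_1\cdots\mathrm{ad}_{-v_p}t_p,\qquad b^\vee_\ell=(-t_1\tilde v_1)\prec(\cdots\prec(-t_p\tilde v_p)\cdots),$$ both equal to $1$ for $p=0$ (an iterated half-shuffle $P_1\prec(\cdots\prec P_p)$ is $P_1$ if $p=1$). **Proposition (dual bases).** 1. For $v_1,v_2\in T_n^*$ and $t_1,t_2\in\mathcal T_{n-1}$, $\langle a(v_1t_1)|r(v_2t_2)\rangle=-\delta_{v_1,v_2}\delta_{t_1,t_2}$.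 Moreover $\mathrm{ad}_{-v}t=(-1)^{|v|}r(vt)$ and $-t\tilde v=(-1)^{|v|}a(vt)$. The families $(r(vt))_{v,t}$ and $(a(vt))_{v,t}$ are linearly independent, $\mathcal I_n$ is the Lie algebra generated by the $r(vt)$, and the elements $-t\tilde v$ have the same linear span as the elements $a(vt)$ and generate the same algebra $Z$ for $\prec$ (without unit). $Z$ is closed under ⧢, the linear forms on $\mathcal I_n$ defined by the elements of $Z$ are exactly those in $\mathcal I_n^\vee$, and $z\in Z$ defines the zero form on $\mathcal I_n$ if and only if it is a linear combination of shuffle products of two elements of $Z$. 2. For $p\ge0$, $v_1,\dots,v_p\in T_n^*$ and $t_1,\dots,t_p\in\mathcal T_{n-1}$, $$\langle a(v_1t_1)\prec(\cdots\prec a(v_pt_p)\cdots)\,|\,r(v_1t_1)\cdots r(v_pt_p)\rangle=(-1)^p.$$ The morphism $\varphi:\mathcal U(\mathcal I_n)\to A\langle\mathcal T_n\rangle$ is injective, with image the linear span of the products $(-1)^{|v_1\cdots v_p|}r(v_1t_1)\cdots r(v_pt_p)$, $p\ge0$; and $P\mapsto\langle P|\varphi(\cdot)\rangle$ is an isomorphism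 from the linear span of the iterated half-shuffles $a(v_1t_1)\prec(\cdots\prec a(v_pt_p)\cdots)$, $p\ge0$, onto $\mathcal U(\mathcal I_n)^\vee$. One has $b^\vee_\ell=-t_1(\tilde v_1⧢(-t_2(\tilde v_2⧢\cdots(-t_p\tilde v_p)\cdots)))$. The family $\mathcal B=(b_\ell)_\ell$ is a basis of $\mathcal U(\mathcal I_n)$, the family $\mathcal B^\vee=(b^\vee_\ell)_\ell$ (as linear forms) is a basis of $\mathcal U(\mathcal I_n)^\vee$, and they are dual up to sign: $\langle b^\vee_\ell|b_m\rangle=(-1)^p\delta_{\ell,m}$, where $p$ is the length of $\ell$. 3. The morphism $\varphi:\mathcal U(\mathcal Lie)\to A\langle\mathcal T_n\rangle$ is bijective and $P\mapsto\langle P|\varphi(\cdot)\rangle$ is an isomorphism from $A\langle\mathcal T_n\rangle$ onto $\mathcal U(\mathcal Lie)^\vee$. The family $T_n^*\mathcal B=(w\,b_\ell)_{w\in T_n^*,\ell}$ is a basis of $\mathcal U(\mathcal Lie)$, and the family $T_n^*⧢\mathcal B^\vee=(w⧢b^\vee_\ell)_{w\in T_n^*,\ell}$ (as linear forms) is a basis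 of $\mathcal U(\mathcal Lie)^\vee$. -/

import Mathlib

attribute [local instance 100] LieRing.ofAssociativeRing

/-! Noncommutative polynomials over an alphabet `X`, concatenation, shuffle, half-shuffle,
the pairing, the antipode and the right normed bracketing. -/

namespace NCPoly

noncomputable section

/-- Noncommutative polynomials `A⟨X⟩`: the algebra of the free monoid of words over `X`. -/
abbrev NC (A X : Type*) [CommRing A] : Type _ := MonoidAlgebra A (FreeMonoid X)

/-- The word `w`, as a polynomial. -/
def word (A : Type*) {X : Type*} [CommRing A] (w : List X) : NC A X :=
  MonoidAlgebra.single (FreeMonoid.ofList w) 1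

/-- The letter `x`, as a polynomial. -/
def letter (A : Type*) {X : Type*} [CommRing A] (x : X) : NC A X := word A [x]

/-- The coefficient of the word `w` in `P`. -/
def coeffWord {A X : Type*} [CommRing A] (P : NC A X) (w : List X) : A :=
  P.coeff (FreeMonoid.ofList w)

/-- Linear extension to `A⟨X⟩` of a map defined on words. -/
def wordExt {A X M : Type*} [CommRing A] [AddCommGroup M] [Module A M]
    (F : List X → M) : NC A X →ₗ[A] M :=
  (Finsupp.linearCombination A (fun w : FreeMonoid X => F w.toList)) ∘ₗ
    (MonoidAlgebra.coeffLinearEquiv A).toLinearMap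

/-- The pairing `⟨S | P⟩ = ∑_w ⟨S | w⟩ ⟨P | w⟩`. -/
def pairing (A X : Type*) [CommRing A] : NC A X →ₗ[A] NC A X →ₗ[A] A :=
  wordExt (fun w => (Finsupp.lapply (FreeMonoid.ofList w)) ∘ₗ
    (MonoidAlgebra.coeffLinearEquiv A).toLinearMap)

/-- The shuffle of two words. -/
def shuffleWord (A : Type*) {X : Type*} [CommRing A] : List X → List X → NC A X
  | [], v => word A v
  | x :: u, [] => word A (x :: u)
  | x :: u, y :: v =>
      letter A x * shuffleWord A u (y :: v) + letter A y * shuffleWord A (x :: u) v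
  termination_by u v => u.length + v.length

/-- The shuffle product on `A⟨X⟩`. -/
def shuffle {A X : Type*} [CommRing A] : NC A X →ₗ[A] NC A X →ₗ[A] NC A X :=
  wordExt (fun u => wordExt (fun v => shuffleWord A u v))

/-- The half-shuffle on `A⟨X⟩`: `1 ≺ R = 0` and `(x H) ≺ R = x (H ⧢ R)` for a letter `x`. -/
def halfShuffle {A X : Type*} [CommRing A] : NC A X →ₗ[A] NC A X →ₗ[A] NC A X :=
  wordExt (fun u => match u with
    | [] => 0
    | x :: h => (LinearMap.mulLeft A (letter A x)) ∘ₗ (shuffle (word A h)))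

/-- The iterated half-shuffle `P₁ ≺ (P₂ ≺ (⋯ ≺ P_p))`; it is `1` for the empty list. -/
def iterHalfShuffle {A X : Type*} [CommRing A] (l : List (NC A X)) : NC A X :=
  l.foldr (fun P R => halfShuffle P R) 1

/-- `a(w) = (-1)^{|w|} w̃`, where `w̃` is the reversal of the word `w`. -/
def antipode {A X : Type*} [CommRing A] : NC A X →ₗ[A] NC A X :=
  wordExt (fun w => (-1 : A) ^ w.length • word A w.reverse)

/-- The right normed bracketing of a word. -/
def bracketWord (A : Type*) {X : Type*} [CommRing A] : List X → NC A X
  | [] => 0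
  | [x] => letter A x
  | x :: y :: l => ⁅letter A x, bracketWord A (y :: l)⁆

/-- The right normed bracketing `r`: `r(1) = 0` and
`r(x₁ ⋯ x_m) = [x₁, [⋯, [x_{m-1}, x_m]⋯]]`. -/
def rightBracket {A X : Type*} [CommRing A] : NC A X →ₗ[A] NC A X :=
  wordExt (bracketWord A)

/-- The smallest submodule of `A⟨X⟩` containing `S` and closed under the half-shuffle. -/
def zinbielSpan {A X : Type*} [CommRing A] (S : Set (NC A X)) : Submodule A (NC A X) :=
  sInf {N | S ⊆ N ∧ ∀ p ∈ N, ∀ q ∈ N, halfShuffle p q ∈ N}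

/-- For a module `M` with a linear map `φ` to `A⟨X⟩` (through which it is graded by the length of
words), the graded dual of `M`: the linear forms which vanish on all elements whose
components of degree `< N` are zero, for some `N`. -/
def gradedDual {A X M : Type*} [CommRing A] [AddCommGroup M] [Module A M]
    (φ : M →ₗ[A] NC A X) : Submodule A (Module.Dual A M) where
  carrier := {f | ∃ N : ℕ, ∀ m : M,
    (∀ w : List X, coeffWord (φ m) w ≠ 0 → N ≤ w.length) → f m = 0}
  zero_mem' := ⟨0, fun _ _ => rfl⟩
  add_mem' := by
    rintro f g ⟨N, hN⟩ ⟨K, hK⟩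
    refine ⟨max N K, fun m hm => ?_⟩
    rw [LinearMap.add_apply, hN m fun w hw => le_trans (le_max_left _ _) (hm w hw),
      hK m fun w hw => le_trans (le_max_right _ _) (hm w hw), add_zero]
  smul_mem' := by
    rintro c f ⟨N, hN⟩
    refine ⟨N, fun m hm => ?_⟩
    rw [LinearMap.smul_apply, hN m hm, smul_zero]

/-- The linear form `m ↦ ⟨P | φ m⟩` on `M`, as a function of the polynomial `P`. -/
def pairingForm {A X M : Type*} [CommRing A] [AddCommGroup M] [Module A M]
    (φ : M →ₗ[A] NC A X) : NC A X →ₗ[A] Module.Dual A M :=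
  (LinearMap.lcomp A A φ) ∘ₗ (pairing A X)

/-- The algebra morphism `U(L) → A⟨X⟩` extending the inclusion of a Lie subalgebra `L`. -/
def envMap {A X : Type*} [CommRing A] (L : LieSubalgebra A (NC A X)) :
    UniversalEnvelopingAlgebra A L →ₐ[A] NC A X :=
  UniversalEnvelopingAlgebra.lift A L.incl

/-- The alphabet `𝒯_n = {t_{i,j}}`, `1 ≤ i < j ≤ n`. -/
abbrev Letters (n : ℕ) : Type := {p : ℕ × ℕ // 1 ≤ p.1 ∧ p.1 < p.2 ∧ p.2 ≤ n}

/-- The letters `t_{i,n}` of `𝒯_n`, which form `T_n`. -/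
abbrev Outer (n : ℕ) : Type := {x : Letters n // x.1.2 = n}

/-- The letters `t_{i,j}` of `𝒯_n` with `j < n`, which form `𝒯_{n-1}`. -/
abbrev Inner (n : ℕ) : Type := {x : Letters n // x.1.2 < n}

/-- Pairs of a word `v` over `T_n` and a letter `t` of `𝒯_{n-1}`. -/
abbrev Gen (n : ℕ) : Type := List (Outer n) × Inner n

/-- A word over `T_n`, as a word over `𝒯_n`. -/
def outerWord {n : ℕ} (v : List (Outer n)) : List (Letters n) := v.map Subtype.val

/-- The word `v t` over `𝒯_n`. -/
def genWord {n : ℕ} (g : Gen n) : List (Letters n) := outerWord g.1 ++ [g.2.1]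

/-- The polynomial `r(v t)`. -/
def rGen (A : Type*) [CommRing A] {n : ℕ} (g : Gen n) : NC A (Letters n) :=
  rightBracket (word A (genWord g))

/-- The polynomial `a(v t)`. -/
def aGen (A : Type*) [CommRing A] {n : ℕ} (g : Gen n) : NC A (Letters n) :=
  antipode (word A (genWord g))

/-- `ad_{-x₁} ∘ ⋯ ∘ ad_{-x_k} (t)` for `v = x₁ ⋯ x_k` in `T_n^*`. -/
def adGen (A : Type*) [CommRing A] {n : ℕ} (g : Gen n) : NC A (Letters n) :=
  g.1.foldr (fun x P => ⁅-letter A x.1, P⁆) (letter A g.2.1)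

/-- The polynomial `-t ṽ`. -/
def tuGen (A : Type*) [CommRing A] {n : ℕ} (g : Gen n) : NC A (Letters n) :=
  -(letter A g.2.1 * word A (outerWord g.1.reverse))

/-- The iterated half-shuffle `(-t₁ ṽ₁) ≺ (⋯ ≺ (-t_p ṽ_p))`. -/
def bVee (A : Type*) [CommRing A] {n : ℕ} (l : List (Gen n)) : NC A (Letters n) :=
  iterHalfShuffle (l.map (tuGen A))

/-- The Lie polynomials over `𝒯_n`. -/
def freeLie (A : Type*) [CommRing A] (n : ℕ) : LieSubalgebra A (NC A (Letters n)) :=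
  LieSubalgebra.lieSpan A _ (Set.range (letter A))

/-- The Lie subalgebra `I_n` generated by the `ad_{-x₁} ∘ ⋯ ∘ ad_{-x_k} (t)`. -/
def lieI (A : Type*) [CommRing A] (n : ℕ) : LieSubalgebra A (NC A (Letters n)) :=
  LieSubalgebra.lieSpan A _ (Set.range (adGen A))

theorem letter_mem (A : Type*) [CommRing A] {n : ℕ} (x : Letters n) :
    letter A x ∈ freeLie A n :=
  LieSubalgebra.subset_lieSpan ⟨x, rfl⟩

theorem adGen_mem (A : Type*) [CommRing A] {n : ℕ} (g : Gen n) : adGen A g ∈ lieI A n :=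
  LieSubalgebra.subset_lieSpan ⟨g, rfl⟩

theorem adGen_mem_freeLie (A : Type*) [CommRing A] {n : ℕ} (g : Gen n) :
    adGen A g ∈ freeLie A n := by
  obtain ⟨v, t⟩ := g
  induction v with
  | nil => exact letter_mem A t.1
  | cons x v ih => exact (freeLie A n).lie_mem ((freeLie A n).neg_mem (letter_mem A x.1)) ih

/-- The element `ad_{-T_n}^{k₁} t₁ ⋯ ad_{-T_n}^{k_p} t_p` of `U(I_n)`, one for each choice of the
letters of `T_n` that are used; it is `1` for the empty list. -/
def bElt (A : Type*) [CommRing A] {n : ℕ} (l : List (Gen n)) :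
    UniversalEnvelopingAlgebra A (lieI A n) :=
  (l.map fun g => UniversalEnvelopingAlgebra.ι A (⟨adGen A g, adGen_mem A g⟩ : lieI A n)).prod

/-- The product in the enveloping algebra of the Lie polynomials of a word over `T_n` and of
`ad_{-T_n}^{k₁} t₁ ⋯ ad_{-T_n}^{k_p} t_p`. -/
def wbElt (A : Type*) [CommRing A] {n : ℕ} (w : List (Outer n)) (l : List (Gen n)) :
    UniversalEnvelopingAlgebra A (freeLie A n) :=
  (w.map fun x =>
      UniversalEnvelopingAlgebra.ι A (⟨letter A x.1, letter_mem A x.1⟩ : freeLie A n)).prod *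
    (l.map fun g =>
      UniversalEnvelopingAlgebra.ι A
        (⟨adGen A g, adGen_mem_freeLie A g⟩ : freeLie A n)).prod

end

end NCPoly

open NCPoly

/-!
Noncommutative polynomials over `X` are paired with themselves so that words are orthonormal.
Deletion of a first letter `x` is adjoint to left multiplication by `x`, and it is a derivation of
the shuffle product; hence so is the adjoint of left multiplication by any Lie polynomial, as
commutators of derivations are derivations (`adjMul_shuffle_of_mem_lieSpan`).

*Duality.* The adjoint of left multiplication by `ad_{-v} t` kills the words over `T_n`, so it
commutes with the shuffle by such a word. Moreover the part of `(ad_{-v} t) R` that begins with a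
letter of `𝒯_{n-1}` is `t ṽ R`. These two facts give, by induction, that the polynomials
`u ⧢ (t₁ ṽ₁ ≺ (⋯ ≺ t_p ṽ_p))` and `w ad_{-v₁} t₁ ⋯ ad_{-v_p} t_p`, for words `u`, `w` over `T_n`,
are dual families (`pairing_shuffle_iterHalfShuffle`). The second family spans `A⟨𝒯_n⟩`, as the
letters of `T_n` can be moved to the left (`span_word_mul_prod_adGen`).

*Enveloping algebras.* A free algebra maps onto the enveloping algebra of a Lie algebra with given
generators, and for `I_n` the composite with the map to `A⟨𝒯_n⟩` is injective by duality. So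
`U(I_n)` is the free algebra on the `ad_{-v} t`, and likewise `U(Lie) = A⟨𝒯_n⟩`; the
Poincaré–Birkhoff–Witt theorem is not needed. As words of a given length are finite in number, a
family dual to a homogeneous basis is a basis of the graded dual (`exists_basis_gradedDual`).

*The dual of `I_n`.* Let `G` be the set of pairs `(v, t)`. The Zinbiel algebra generated by the
`t ṽ` is the image of the polynomials over `G` without constant term under a morphism for `≺` and
for `⧢`, adjoint to the isomorphism of the free algebra over `G` with `U(I_n)`
(`zinbielSpan_range`, `pairing_zinbielHom_evalHom`). This reduces the claims on `I_n` to the free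
Lie algebra over `G`. There the adjoint of the right normed bracketing sends a word `w` to
`∑_{uv = w} |u| u ⧢ a(v)`, which is `|w| w` modulo shuffle products of polynomials without constant
term (`pairing_dynkinAdjWord`, `smul_word_sub_dynkinAdjWord_mem`). Division by `|w|` gives a
projector onto the Lie polynomials whose adjoint is the identity modulo such products. It extends
the linear forms on the Lie polynomials, and shows that the polynomials without constant term which
are orthogonal to the Lie polynomials are sums of such products.
-/

namespace NCPoly

noncomputable section

variable {A X : Type*} [CommRing A]

/-! ### Words and the pairing -/

theorem word_nil : word A ([] : List X) = 1 := rfl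

theorem word_append (u v : List X) : word A (u ++ v) = word A u * word A v := by
  simp [word, MonoidAlgebra.single_mul_single]

theorem word_cons (x : X) (w : List X) : word A (x :: w) = letter A x * word A w :=
  word_append [x] w

theorem NC.induct {p : NC A X → Prop} (hword : ∀ w, p (word A w))
    (hadd : ∀ P Q, p P → p Q → p (P + Q)) (hsmul : ∀ (c : A) P, p P → p (c • P)) (P : NC A X) :
    p P := by
  refine MonoidAlgebra.induction_linear P ?_ hadd fun w c => ?_
  · simpa using hsmul 0 _ (hword [])
  · have : MonoidAlgebra.single w c = c • word A w.toList := by simp [word]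
    rw [this]
    exact hsmul c _ (hword _)

theorem wordExt_word {M : Type*} [AddCommGroup M] [Module A M] (F : List X → M) (w : List X) :
    wordExt F (word A w) = F w := by
  change Finsupp.linearCombination A (fun w : FreeMonoid X => F w.toList)
    (Finsupp.single (FreeMonoid.ofList w) 1) = F w
  simp

theorem coeffWord_word [DecidableEq X] (u v : List X) :
    coeffWord (word A u) v = if u = v then 1 else 0 := by
  classical
  simp [coeffWord, word, Finsupp.single_apply]

theorem coeffWord_add (P Q : NC A X) (w : List X) :
    coeffWord (P + Q) w = coeffWord P w + coeffWord Q w := rfl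

theorem coeffWord_smul (c : A) (P : NC A X) (w : List X) :
    coeffWord (c • P) w = c * coeffWord P w := rfl

theorem coeffWord_ext {P Q : NC A X} (h : ∀ w, coeffWord P w = coeffWord Q w) : P = Q := by
  refine MonoidAlgebra.coeff_injective (Finsupp.ext fun w => h w.toList)

theorem pairing_word_left (w : List X) (P : NC A X) :
    pairing A X (word A w) P = coeffWord P w := by
  rw [pairing, wordExt_word]
  rfl

theorem pairing_word_word [DecidableEq X] (u v : List X) :
    pairing A X (word A u) (word A v) = if u = v then 1 else 0 := by
  rw [pairing_word_left, coeffWord_word]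
  simp only [eq_comm]

theorem pairing_comm (P Q : NC A X) : pairing A X P Q = pairing A X Q P := by
  classical
  induction P using NC.induct with
  | hadd P P' h h' => simp [h, h']
  | hsmul c P h => simp [h]
  | hword u =>
    induction Q using NC.induct with
    | hadd P P' h h' => simp [h, h']
    | hsmul c P h => simp [h]
    | hword v => simp only [pairing_word_word, eq_comm]

/-- The pairing is nondegenerate. -/
theorem ext_pairing {P Q : NC A X} (h : ∀ w, pairing A X P (word A w) = pairing A X Q (word A w)) :
    P = Q :=
  coeffWord_ext fun w => by
    rw [← pairing_word_left, ← pairing_word_left, pairing_comm, h, pairing_comm]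

theorem ext_pairing_right {P Q : NC A X}
    (h : ∀ w, pairing A X (word A w) P = pairing A X (word A w) Q) : P = Q :=
  ext_pairing fun w => by rw [pairing_comm, h, pairing_comm]

/-- The constant term. -/
def constTerm (A X : Type*) [CommRing A] : NC A X →ₗ[A] A := (pairing A X).flip 1

theorem constTerm_apply (P : NC A X) : constTerm A X P = pairing A X P 1 := rfl

theorem constTerm_word [DecidableEq X] (w : List X) :
    constTerm A X (word A w) = if w = [] then 1 else 0 := by
  rw [constTerm_apply, ← word_nil, pairing_word_word]

@[simp] theorem constTerm_one : constTerm A X 1 = 1 := by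
  classical
  rw [← word_nil, constTerm_word]
  simp

@[simp] theorem constTerm_letter_mul (x : X) (P : NC A X) :
    constTerm A X (letter A x * P) = 0 := by
  classical
  induction P using NC.induct with
  | hadd P P' h h' => simp [mul_add, h, h']
  | hsmul c P h => simp [h]
  | hword u => rw [← word_cons, constTerm_word]; simp

/-! ### Deletion of the first letter -/

open Classical in
/-- Deletion of the first letter: `x w ↦ w`, and words which do not begin with `x` go to `0`. -/
def leftDel (A : Type*) {X : Type*} [CommRing A] (x : X) : NC A X →ₗ[A] NC A X :=
  wordExt fun w => match w with
    | [] => 0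
    | y :: w => if y = x then word A w else 0

@[simp] theorem leftDel_one (x : X) : leftDel A x 1 = 0 := by
  rw [← word_nil, leftDel, wordExt_word]

theorem leftDel_word_cons [DecidableEq X] (x y : X) (w : List X) :
    leftDel A x (word A (y :: w)) = if y = x then word A w else 0 := by
  rw [leftDel, wordExt_word]
  simp only
  congr

theorem leftDel_letter_mul [DecidableEq X] (x y : X) (P : NC A X) :
    leftDel A x (letter A y * P) = if y = x then P else 0 := by
  induction P using NC.induct with
  | hadd P P' h h' => rw [mul_add, map_add, h, h']; split_ifs <;> simp
  | hsmul c P h => rw [mul_smul_comm, map_smul, h]; split_ifs <;> simp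
  | hword w => rw [← word_cons, leftDel_word_cons]

/-- Deletion of a first letter `x` is adjoint to multiplication by `x` on the left. -/
theorem pairing_letter_mul (x : X) (P Q : NC A X) :
    pairing A X P (letter A x * Q) = pairing A X (leftDel A x P) Q := by
  classical
  induction P using NC.induct with
  | hadd P P' h h' => simp [h, h']
  | hsmul c P h => simp [h]
  | hword u =>
    induction Q using NC.induct with
    | hadd P P' h h' => simp [h, h', mul_add]
    | hsmul c P h => simp [h]
    | hword v =>
      rw [← word_cons, pairing_word_word]
      cases u with
      | nil => simp [word_nil]
      | cons y u =>
        rw [leftDel_word_cons]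
        by_cases h : y = x <;> simp [h, pairing_word_word]

/-- A polynomial is determined by its constant term and by the deletions of its first letters. -/
theorem ext_leftDel {P Q : NC A X} (h0 : constTerm A X P = constTerm A X Q)
    (h : ∀ x, leftDel A x P = leftDel A x Q) : P = Q :=
  ext_pairing fun w => by
    cases w with
    | nil => exact h0
    | cons x w => rw [word_cons, pairing_letter_mul, pairing_letter_mul, h]

/-- The adjoint of multiplication by a polynomial on the left: on a word `x₁ ⋯ x_m`, the
deletion of `x₁`, then of `x₂`, up to `x_m`. -/
def adjMul (A X : Type*) [CommRing A] : NC A X →ₗ[A] Module.End A (NC A X) :=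
  wordExt fun w => w.foldr (fun x f => f ∘ₗ leftDel A x) LinearMap.id

theorem pairing_mul (a P R : NC A X) :
    pairing A X P (a * R) = pairing A X (adjMul A X a P) R := by
  induction a using NC.induct with
  | hadd P P' h h' => simp [h, h', add_mul]
  | hsmul c P h => simp [h]
  | hword u =>
    rw [adjMul, wordExt_word]
    induction u generalizing P with
    | nil => simp [word_nil]
    | cons x u ih => rw [word_cons, mul_assoc, pairing_letter_mul, ih]; rfl

theorem adjMul_mul (a b : NC A X) : adjMul A X (a * b) = adjMul A X b ∘ₗ adjMul A X a := by
  refine LinearMap.ext fun P => ext_pairing fun w => ?_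
  rw [← pairing_mul, mul_assoc, pairing_mul, pairing_mul]
  rfl

theorem adjMul_letter (x : X) : adjMul A X (letter A x) = leftDel A x := by
  refine LinearMap.ext fun P => ext_pairing fun w => ?_
  rw [← pairing_mul, pairing_letter_mul]

/-! ### The shuffle and the half-shuffle -/

theorem shuffle_word_word (u v : List X) :
    shuffle (word A u) (word A v) = shuffleWord A u v := by
  rw [shuffle, wordExt_word, wordExt_word]

@[simp] theorem one_shuffle (P : NC A X) : shuffle 1 P = P := by
  induction P using NC.induct with
  | hadd P P' h h' => simp [h, h']
  | hsmul c P h => simp [h]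
  | hword u => rw [← word_nil, shuffle_word_word, shuffleWord]

@[simp] theorem shuffle_one (P : NC A X) : shuffle P 1 = P := by
  induction P using NC.induct with
  | hadd P P' h h' => simp [h, h']
  | hsmul c P h => simp [h]
  | hword u => rw [← word_nil, shuffle_word_word]; cases u <;> rw [shuffleWord]

theorem shuffle_letter_mul (x y : X) (P Q : NC A X) :
    shuffle (letter A x * P) (letter A y * Q) =
      letter A x * shuffle P (letter A y * Q) + letter A y * shuffle (letter A x * P) Q := by
  induction P using NC.induct with
  | hadd P P' h h' => simp only [mul_add, map_add, LinearMap.add_apply, h, h']; abel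
  | hsmul c P h => simp only [mul_smul_comm, map_smul, LinearMap.smul_apply, h, smul_add]
  | hword u =>
    induction Q using NC.induct with
    | hadd P P' h h' => simp only [mul_add, map_add, h, h']; abel
    | hsmul c P h => simp only [mul_smul_comm, map_smul, h, smul_add]
    | hword v => simp only [← word_cons, shuffle_word_word]; rw [shuffleWord]

/-- Deletion of a first letter is a derivation of the shuffle product. -/
theorem leftDel_shuffle (x : X) (P Q : NC A X) :
    leftDel A x (shuffle P Q) = shuffle (leftDel A x P) Q + shuffle P (leftDel A x Q) := by
  classical
  induction P using NC.induct with
  | hadd P P' h h' => simp only [map_add, LinearMap.add_apply, h, h']; abel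
  | hsmul c P h => simp only [map_smul, LinearMap.smul_apply, h, smul_add]
  | hword u =>
    induction Q using NC.induct with
    | hadd P P' h h' => simp only [map_add, h, h']; abel
    | hsmul c P h => simp only [map_smul, h, smul_add]
    | hword v =>
      cases u with
      | nil => simp [word_nil]
      | cons y u =>
        cases v with
        | nil => simp [word_nil]
        | cons z v =>
          simp only [word_cons, shuffle_letter_mul, map_add, leftDel_letter_mul]
          split_ifs <;> simp

theorem constTerm_shuffle (P Q : NC A X) :
    constTerm A X (shuffle P Q) = constTerm A X P * constTerm A X Q := by
  induction P using NC.induct with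
  | hadd P P' h h' => simp only [map_add, LinearMap.add_apply, h, h', add_mul]
  | hsmul c P h => simp only [map_smul, LinearMap.smul_apply, h, smul_eq_mul, mul_assoc]
  | hword u =>
    induction Q using NC.induct with
    | hadd P P' h h' => simp only [map_add, h, h', mul_add]
    | hsmul c P h => simp only [map_smul, h, smul_eq_mul, mul_left_comm]
    | hword v =>
      cases u with
      | nil => simp [word_nil]
      | cons y u =>
        cases v with
        | nil => simp [word_nil]
        | cons z v => simp [word_cons, shuffle_letter_mul]

theorem leftDel_word_eq (x : X) (w : List X) :
    leftDel A x (word A w) = 0 ∨ ∃ v : List X, w = x :: v ∧ leftDel A x (word A w) = word A v := by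
  classical
  cases w with
  | nil => exact Or.inl (leftDel_one x)
  | cons y w =>
    rw [leftDel_word_cons]
    by_cases h : y = x
    · exact Or.inr ⟨w, by rw [h], if_pos h⟩
    · exact Or.inl (if_neg h)

theorem shuffle_comm (P Q : NC A X) : shuffle P Q = shuffle Q P := by
  induction P using NC.induct with
  | hadd P P' h h' => simp only [map_add, LinearMap.add_apply, h, h']
  | hsmul c P h => simp only [map_smul, LinearMap.smul_apply, h]
  | hword u =>
    induction Q using NC.induct with
    | hadd P P' h h' => simp only [map_add, LinearMap.add_apply, h, h']
    | hsmul c P h => simp only [map_smul, LinearMap.smul_apply, h]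
    | hword v =>
      induction hk : u.length + v.length using Nat.strong_induction_on generalizing u v with
      | _ k ih =>
        refine ext_leftDel (by simp only [constTerm_shuffle, mul_comm]) fun x => ?_
        rw [leftDel_shuffle, leftDel_shuffle, add_comm]
        congr 1
        · rcases leftDel_word_eq (A := A) x v with h | ⟨v', rfl, h⟩
          · simp [h]
          · rw [h, ih _ _ _ _ rfl]
            simp at hk; omega
        · rcases leftDel_word_eq (A := A) x u with h | ⟨u', rfl, h⟩
          · simp [h]
          · rw [h, ih _ _ _ _ rfl]
            simp at hk; omega

theorem shuffle_assoc (P Q R : NC A X) :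
    shuffle (shuffle P Q) R = shuffle P (shuffle Q R) := by
  induction P using NC.induct with
  | hadd P P' h h' => simp only [map_add, LinearMap.add_apply, h, h']
  | hsmul c P h => simp only [map_smul, LinearMap.smul_apply, h]
  | hword u =>
    induction Q using NC.induct with
    | hadd P P' h h' => simp only [map_add, LinearMap.add_apply, h, h']
    | hsmul c P h => simp only [map_smul, LinearMap.smul_apply, h]
    | hword v =>
      induction R using NC.induct with
      | hadd P P' h h' => simp only [map_add, h, h']
      | hsmul c P h => simp only [map_smul, h]
      | hword w =>
        induction hk : u.length + v.length + w.length using Nat.strong_induction_on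
          generalizing u v w with
        | _ k ih =>
          refine ext_leftDel (by simp only [constTerm_shuffle, mul_assoc]) fun x => ?_
          simp only [leftDel_shuffle, map_add, LinearMap.add_apply, add_assoc]
          congr 1
          · rcases leftDel_word_eq (A := A) x u with h | ⟨u', rfl, h⟩
            · simp [h]
            · rw [h, ih _ _ _ _ _ rfl]
              simp at hk; omega
          congr 1
          · rcases leftDel_word_eq (A := A) x v with h | ⟨v', rfl, h⟩
            · simp [h]
            · rw [h, ih _ _ _ _ _ rfl]
              simp at hk; omega
          · rcases leftDel_word_eq (A := A) x w with h | ⟨w', rfl, h⟩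
            · simp [h]
            · rw [h, ih _ _ _ _ _ rfl]
              simp at hk; omega

@[simp] theorem one_halfShuffle (R : NC A X) : halfShuffle 1 R = 0 := by
  rw [← word_nil, halfShuffle, wordExt_word]
  rfl

theorem letter_mul_halfShuffle (x : X) (H R : NC A X) :
    halfShuffle (letter A x * H) R = letter A x * shuffle H R := by
  induction H using NC.induct with
  | hadd P P' h h' => simp only [mul_add, map_add, LinearMap.add_apply, h, h']
  | hsmul c P h => simp only [mul_smul_comm, map_smul, LinearMap.smul_apply, h]
  | hword w => rw [← word_cons, halfShuffle, wordExt_word]; rfl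

/-- The shuffle product is the symmetrization of the half-shuffle, up to the constant terms. -/
theorem shuffle_eq_halfShuffle_add (P Q : NC A X) :
    shuffle P Q = halfShuffle P Q + halfShuffle Q P +
      (constTerm A X P * constTerm A X Q) • 1 := by
  induction P using NC.induct with
  | hadd P P' h h' =>
    simp only [map_add, LinearMap.add_apply, h, h', add_mul, add_smul]; abel
  | hsmul c P h =>
    simp only [map_smul, LinearMap.smul_apply, h, smul_add, smul_smul, smul_eq_mul, mul_assoc]
  | hword u =>
    induction Q using NC.induct with
    | hadd P P' h h' => simp only [map_add, LinearMap.add_apply, h, h', mul_add, add_smul]; abel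
    | hsmul c P h =>
      simp only [map_smul, LinearMap.smul_apply, h, smul_add, smul_smul, smul_eq_mul,
        mul_left_comm]
    | hword v =>
      cases u with
      | nil =>
        cases v with
        | nil => simp [word_nil]
        | cons z v => simp [word_nil, word_cons, letter_mul_halfShuffle]
      | cons y u =>
        cases v with
        | nil => simp [word_nil, word_cons, letter_mul_halfShuffle]
        | cons z v =>
          simp only [word_cons, shuffle_letter_mul, letter_mul_halfShuffle, constTerm_letter_mul,
            mul_zero, zero_smul, add_zero]
          rw [shuffle_comm (letter A y * _)]

@[simp] theorem constTerm_halfShuffle (P Q : NC A X) :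
    constTerm A X (halfShuffle P Q) = 0 := by
  induction P using NC.induct with
  | hadd P P' h h' => simp only [map_add, LinearMap.add_apply, h, h', add_zero]
  | hsmul c P h => simp only [map_smul, LinearMap.smul_apply, h, smul_zero]
  | hword u =>
    cases u with
    | nil => simp [word_nil]
    | cons x u => simp [word_cons, letter_mul_halfShuffle]

theorem halfShuffle_one {P : NC A X} (hP : constTerm A X P = 0) : halfShuffle P 1 = P := by
  have h := shuffle_eq_halfShuffle_add P 1
  simpa [hP] using h.symm

/-- The Zinbiel relation. -/
theorem halfShuffle_halfShuffle (P Q R : NC A X) :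
    halfShuffle (halfShuffle P Q) R = halfShuffle P (shuffle Q R) := by
  induction P using NC.induct with
  | hadd P P' h h' => simp only [map_add, LinearMap.add_apply, h, h']
  | hsmul c P h => simp only [map_smul, LinearMap.smul_apply, h]
  | hword u =>
    cases u with
    | nil => simp [word_nil]
    | cons x u => simp only [word_cons, letter_mul_halfShuffle, shuffle_assoc]

/-! ### Lie polynomials and shuffles -/

/-- Lie polynomials are primitive: the adjoint of multiplication by a Lie polynomial is a
derivation of the shuffle product. -/
theorem adjMul_shuffle_of_mem_lieSpan {a : NC A X}
    (ha : a ∈ LieSubalgebra.lieSpan A (NC A X) (Set.range (letter A))) (P Q : NC A X) :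
    adjMul A X a (shuffle P Q) = shuffle (adjMul A X a P) Q + shuffle P (adjMul A X a Q) := by
  induction ha using LieSubalgebra.lieSpan_induction generalizing P Q with
  | mem x hx =>
    obtain ⟨x, rfl⟩ := hx
    rw [adjMul_letter, leftDel_shuffle]
  | zero => simp
  | add x y _ _ hx hy => simp only [map_add, LinearMap.add_apply, hx, hy]; abel
  | smul c x _ hx => simp only [map_smul, LinearMap.smul_apply, hx, smul_add]
  | lie x y _ _ hx hy =>
    simp only [LieRing.of_associative_ring_bracket, map_sub, adjMul_mul, LinearMap.sub_apply,
      LinearMap.comp_apply, hx, hy, map_add]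
    abel

theorem constTerm_adjMul (a P : NC A X) :
    constTerm A X (adjMul A X a P) = pairing A X P a := by
  rw [constTerm_apply, ← pairing_mul, mul_one]

/-- Lie polynomials are orthogonal to the shuffle products of polynomials without constant
term. -/
theorem pairing_shuffle_of_mem_lieSpan {a : NC A X}
    (ha : a ∈ LieSubalgebra.lieSpan A (NC A X) (Set.range (letter A))) {P Q : NC A X}
    (hP : constTerm A X P = 0) (hQ : constTerm A X Q = 0) : pairing A X (shuffle P Q) a = 0 := by
  rw [← constTerm_adjMul, adjMul_shuffle_of_mem_lieSpan ha, map_add, constTerm_shuffle,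
    constTerm_shuffle, hP, hQ, mul_zero, zero_mul, add_zero]

end

noncomputable section

variable {A X : Type*} [CommRing A]

/-! ### Morphisms out of noncommutative polynomials -/

variable {G : Type*}

/-- The morphism from the free algebra which sends the letter `g` to `f g`. -/
def evalHom {B : Type*} [Ring B] [Algebra A B] (f : G → B) : NC A G →ₐ[A] B :=
  MonoidAlgebra.lift A B (FreeMonoid G) (FreeMonoid.lift f)

theorem evalHom_word {B : Type*} [Ring B] [Algebra A B] (f : G → B) (l : List G) :
    evalHom f (word A l) = (l.map f).prod := by
  simp [evalHom, word, FreeMonoid.lift_apply]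

theorem evalHom_letter {B : Type*} [Ring B] [Algebra A B] (f : G → B) (g : G) :
    evalHom f (letter A g) = f g := by
  simp [letter, evalHom_word]

theorem evalHom_comp_evalHom {B C : Type*} [Ring B] [Algebra A B] [Ring C] [Algebra A C]
    (φ : B →ₐ[A] C) (f : G → B) (P : NC A G) :
    φ (evalHom f P) = evalHom (fun g => φ (f g)) P := by
  induction P using NC.induct with
  | hadd P P' h h' => simp only [map_add, h, h']
  | hsmul c P h => simp only [map_smul, h]
  | hword l => simp [evalHom_word, map_list_prod, Function.comp_def]

theorem evalHom_letter_eq_id (P : NC A X) : evalHom (letter A) P = P := by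
  induction P using NC.induct with
  | hadd P P' h h' => simp only [map_add, h, h']
  | hsmul c P h => simp only [map_smul, h]
  | hword l =>
    rw [evalHom_word]
    induction l with
    | nil => rfl
    | cons x l ih => rw [List.map_cons, List.prod_cons, ih, word_cons]

/-- The linear map from the polynomials over `G` which sends the word `g₁ ⋯ g_p` to
`f g₁ ≺ (⋯ ≺ f g_p)`. It is the morphism of Zinbiel algebras that extends `f`, see
`zinbielHom_halfShuffle`: the polynomials without constant term are the free Zinbiel algebra. -/
def zinbielHom (f : G → NC A X) : NC A G →ₗ[A] NC A X :=
  wordExt fun l => iterHalfShuffle (l.map f)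

theorem zinbielHom_word (f : G → NC A X) (l : List G) :
    zinbielHom f (word A l) = iterHalfShuffle (l.map f) := wordExt_word _ _

@[simp] theorem zinbielHom_one (f : G → NC A X) : zinbielHom f 1 = 1 := zinbielHom_word f []

theorem zinbielHom_letter_mul (f : G → NC A X) (g : G) (P : NC A G) :
    zinbielHom f (letter A g * P) = halfShuffle (f g) (zinbielHom f P) := by
  induction P using NC.induct with
  | hadd P P' h h' => simp only [mul_add, map_add, h, h']
  | hsmul c P h => simp only [mul_smul_comm, map_smul, h]
  | hword l =>
    rw [← word_cons, zinbielHom_word, zinbielHom_word]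
    rfl

theorem zinbielHom_shuffle (f : G → NC A X) (P Q : NC A G) :
    zinbielHom f (shuffle P Q) = shuffle (zinbielHom f P) (zinbielHom f Q) := by
  induction P using NC.induct with
  | hadd P P' h h' => simp only [map_add, LinearMap.add_apply, h, h']
  | hsmul c P h => simp only [map_smul, LinearMap.smul_apply, h]
  | hword u =>
    induction Q using NC.induct with
    | hadd P P' h h' => simp only [map_add, h, h']
    | hsmul c P h => simp only [map_smul, h]
    | hword v =>
      induction hk : u.length + v.length using Nat.strong_induction_on generalizing u v with
      | _ k ih =>
        cases u with
        | nil => simp [word_nil]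
        | cons g u =>
          cases v with
          | nil => simp [word_nil]
          | cons h v =>
            rw [word_cons, word_cons, shuffle_letter_mul, map_add, zinbielHom_letter_mul,
              zinbielHom_letter_mul, ← word_cons, ← word_cons,
              ih _ (by simp at hk ⊢; omega) u (h :: v) rfl,
              ih _ (by simp at hk ⊢; omega) (g :: u) v rfl,
              shuffle_comm (zinbielHom f (word A (g :: u))) (zinbielHom f (word A v)),
              shuffle_eq_halfShuffle_add (zinbielHom f (word A (g :: u))), word_cons, word_cons,
              zinbielHom_letter_mul, zinbielHom_letter_mul, halfShuffle_halfShuffle,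
              halfShuffle_halfShuffle]
            simp

theorem zinbielHom_halfShuffle (f : G → NC A X) (P Q : NC A G) :
    zinbielHom f (halfShuffle P Q) = halfShuffle (zinbielHom f P) (zinbielHom f Q) := by
  induction P using NC.induct with
  | hadd P P' h h' => simp only [map_add, LinearMap.add_apply, h, h']
  | hsmul c P h => simp only [map_smul, LinearMap.smul_apply, h]
  | hword u =>
    cases u with
    | nil => simp [word_nil]
    | cons g u =>
      rw [word_cons, letter_mul_halfShuffle, zinbielHom_letter_mul, zinbielHom_letter_mul,
        halfShuffle_halfShuffle, zinbielHom_shuffle]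

theorem zinbielHom_letter {f : G → NC A X} {g : G} (hf : constTerm A X (f g) = 0) :
    zinbielHom f (letter A g) = f g := by
  rw [← mul_one (letter A g), zinbielHom_letter_mul, zinbielHom_one, halfShuffle_one hf]

theorem constTerm_zinbielHom (f : G → NC A X) (P : NC A G) :
    constTerm A X (zinbielHom f P) = constTerm A G P := by
  induction P using NC.induct with
  | hadd P P' h h' => simp only [map_add, h, h']
  | hsmul c P h => simp only [map_smul, h]
  | hword u =>
    cases u with
    | nil => simp [word_nil]
    | cons g u => simp [word_cons, zinbielHom_letter_mul]

/-- The polynomials without constant term are spanned by the nonempty words. -/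
theorem mem_of_constTerm_eq_zero {P : NC A G} (hP : constTerm A G P = 0)
    {N : Submodule A (NC A G)} (hN : ∀ g l, word A (g :: l) ∈ N) : P ∈ N := by
  have key : ∀ Q : NC A G, Q - constTerm A G Q • 1 ∈ N := by
    intro Q
    induction Q using NC.induct with
    | hadd P P' h h' =>
      rw [map_add, add_smul, add_sub_add_comm]
      exact N.add_mem h h'
    | hsmul c P h =>
      rw [map_smul, smul_assoc, ← smul_sub]
      exact N.smul_mem c h
    | hword u =>
      cases u with
      | nil => simp [word_nil]
      | cons g u =>
        have := hN g u
        rw [word_cons] at this ⊢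
        simpa using this
  simpa [hP] using key P

theorem zinbielSpan_le {S : Set (NC A X)} {N : Submodule A (NC A X)} (hS : S ⊆ N)
    (hN : ∀ p ∈ N, ∀ q ∈ N, halfShuffle p q ∈ N) : zinbielSpan S ≤ N :=
  sInf_le ⟨hS, hN⟩

theorem subset_zinbielSpan (S : Set (NC A X)) : S ⊆ zinbielSpan S := fun _ hs =>
  Submodule.mem_sInf.2 fun _ hN => hN.1 hs

theorem halfShuffle_mem_zinbielSpan {S : Set (NC A X)} {p q : NC A X} (hp : p ∈ zinbielSpan S)
    (hq : q ∈ zinbielSpan S) : halfShuffle p q ∈ zinbielSpan S :=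
  Submodule.mem_sInf.2 fun N hN =>
    hN.2 p (Submodule.mem_sInf.1 hp N hN) q (Submodule.mem_sInf.1 hq N hN)

/-- The Zinbiel algebra generated by a family `f` of polynomials without constant term is the
image under `zinbielHom f` of the polynomials without constant term. -/
theorem zinbielSpan_range {f : G → NC A X} (hf : ∀ g, constTerm A X (f g) = 0) :
    zinbielSpan (Set.range f) = (LinearMap.ker (constTerm A G)).map (zinbielHom f) := by
  refine le_antisymm (zinbielSpan_le ?_ ?_) ?_
  · rintro _ ⟨g, rfl⟩
    refine ⟨letter A g, ?_, zinbielHom_letter (hf g)⟩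
    simpa using constTerm_letter_mul (A := A) g 1
  · rintro _ ⟨P, -, rfl⟩ _ ⟨Q, -, rfl⟩
    exact ⟨halfShuffle P Q, constTerm_halfShuffle P Q, zinbielHom_halfShuffle f P Q⟩
  · rw [Submodule.map_le_iff_le_comap]
    intro P hP
    refine mem_of_constTerm_eq_zero hP fun g l => ?_
    rw [Submodule.mem_comap]
    have hg : f g ∈ zinbielSpan (Set.range f) := subset_zinbielSpan _ ⟨g, rfl⟩
    induction l generalizing g with
    | nil => rwa [← letter, zinbielHom_letter (hf g)]
    | cons h l ih =>
      rw [word_cons, zinbielHom_letter_mul]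
      exact halfShuffle_mem_zinbielSpan hg (ih h (subset_zinbielSpan _ ⟨h, rfl⟩))

theorem zinbielSpan_range_le {c : G → A} {f f' : G → NC A X} (h : ∀ g, f g = c g • f' g) :
    zinbielSpan (Set.range f) ≤ zinbielSpan (Set.range f') := by
  refine zinbielSpan_le ?_ fun p hp q hq => halfShuffle_mem_zinbielSpan hp hq
  rintro _ ⟨g, rfl⟩
  rw [h]
  exact Submodule.smul_mem _ _ (subset_zinbielSpan _ ⟨g, rfl⟩)

theorem lieSpan_range_le {c : G → A} {f f' : G → NC A X} (h : ∀ g, f g = c g • f' g) :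
    LieSubalgebra.lieSpan A (NC A X) (Set.range f) ≤
      LieSubalgebra.lieSpan A (NC A X) (Set.range f') := by
  refine LieSubalgebra.lieSpan_le.2 ?_
  rintro _ ⟨g, rfl⟩
  rw [h]
  exact LieSubalgebra.smul_mem _ _ (LieSubalgebra.subset_lieSpan ⟨g, rfl⟩)

theorem span_range_le {c : G → A} {f f' : G → NC A X} (h : ∀ g, f g = c g • f' g) :
    Submodule.span A (Set.range f) ≤ Submodule.span A (Set.range f') := by
  refine Submodule.span_le.2 ?_
  rintro _ ⟨g, rfl⟩
  rw [h]
  exact Submodule.smul_mem _ _ (Submodule.subset_span ⟨g, rfl⟩)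

theorem iterHalfShuffle_map_eq_smul {c : G → A} {f f' : G → NC A X} (h : ∀ g, f g = c g • f' g)
    (l : List G) : iterHalfShuffle (l.map f) = (l.map c).prod • iterHalfShuffle (l.map f') := by
  induction l with
  | nil => simp [iterHalfShuffle]
  | cons g l ih =>
    simp only [iterHalfShuffle, List.map_cons, List.foldr_cons, List.prod_cons] at ih ⊢
    rw [ih, h, map_smul, map_smul, LinearMap.smul_apply, smul_smul, mul_comm]

theorem list_prod_map_eq_smul {c : G → A} {f f' : G → NC A X} (h : ∀ g, f g = c g • f' g)
    (l : List G) : (l.map f).prod = (l.map c).prod • (l.map f').prod := by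
  induction l with
  | nil => simp
  | cons g l ih =>
    simp only [List.map_cons, List.prod_cons, ih, h, smul_mul_assoc, mul_smul_comm, smul_smul,
      mul_comm]

theorem map_evalHom_lieSpan (f : G → NC A X) :
    (LieSubalgebra.lieSpan A (NC A G) (Set.range (letter A))).map (evalHom f).toLieHom =
      LieSubalgebra.lieSpan A (NC A X) (Set.range f) := by
  rw [LieSubalgebra.map_lieSpan, ← Set.range_comp]
  congr 2
  funext g
  exact evalHom_letter f g

theorem range_evalHom (f : G → NC A X) :
    LinearMap.range (evalHom f).toLinearMap =
      Submodule.span A (Set.range fun l : List G => (l.map f).prod) := by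
  refine le_antisymm ?_ ?_
  · rintro _ ⟨P, rfl⟩
    induction P using NC.induct with
    | hadd P P' h h' => rw [map_add]; exact Submodule.add_mem _ h h'
    | hsmul c P h => rw [map_smul]; exact Submodule.smul_mem _ _ h
    | hword l => exact Submodule.subset_span ⟨l, (evalHom_word f l).symm⟩
  · rw [Submodule.span_le]
    rintro _ ⟨l, rfl⟩
    exact ⟨word A l, evalHom_word f l⟩

theorem range_zinbielHom (f : G → NC A X) :
    LinearMap.range (zinbielHom f) =
      Submodule.span A (Set.range fun l : List G => iterHalfShuffle (l.map f)) := by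
  refine le_antisymm ?_ ?_
  · rintro _ ⟨P, rfl⟩
    induction P using NC.induct with
    | hadd P P' h h' => rw [map_add]; exact Submodule.add_mem _ h h'
    | hsmul c P h => rw [map_smul]; exact Submodule.smul_mem _ _ h
    | hword l => exact Submodule.subset_span ⟨l, (zinbielHom_word f l).symm⟩
  · rw [Submodule.span_le]
    rintro _ ⟨l, rfl⟩
    exact ⟨word A l, zinbielHom_word f l⟩

/-! ### Homogeneous polynomials -/

/-- The homogeneous polynomials of degree `d`, for the length of words. -/
def homogeneous (A X : Type*) [CommRing A] (d : ℕ) : Submodule A (NC A X) :=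
  Submodule.span A (word A '' {w | w.length = d})

theorem word_mem_homogeneous (w : List X) : word A w ∈ homogeneous A X w.length :=
  Submodule.subset_span ⟨w, rfl, rfl⟩

theorem letter_mem_homogeneous (x : X) : letter A x ∈ homogeneous A X 1 :=
  word_mem_homogeneous [x]

theorem mul_mem_homogeneous {d e : ℕ} {P Q : NC A X} (hP : P ∈ homogeneous A X d)
    (hQ : Q ∈ homogeneous A X e) : P * Q ∈ homogeneous A X (d + e) := by
  have h := Submodule.mul_mem_mul hP hQ
  rw [homogeneous, homogeneous, Submodule.span_mul_span] at h
  refine Submodule.span_mono ?_ h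
  rintro _ ⟨_, ⟨u, rfl, rfl⟩, _, ⟨v, rfl, rfl⟩, rfl⟩
  exact ⟨u ++ v, by simp, word_append u v⟩

theorem lie_mem_homogeneous {d e : ℕ} {P Q : NC A X} (hP : P ∈ homogeneous A X d)
    (hQ : Q ∈ homogeneous A X e) : ⁅P, Q⁆ ∈ homogeneous A X (d + e) := by
  rw [LieRing.of_associative_ring_bracket]
  exact Submodule.sub_mem _ (mul_mem_homogeneous hP hQ) (add_comm d e ▸ mul_mem_homogeneous hQ hP)

theorem length_eq_of_mem_homogeneous {d : ℕ} {P : NC A X} (hP : P ∈ homogeneous A X d)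
    {w : List X} (hw : coeffWord P w ≠ 0) : w.length = d := by
  classical
  by_contra h
  refine hw ?_
  induction hP using Submodule.span_induction with
  | mem P hP =>
    obtain ⟨u, hu, rfl⟩ := hP
    rw [coeffWord_word, if_neg]
    rintro rfl
    exact h hu
  | zero => rfl
  | add P Q _ _ hP hQ =>
    rw [coeffWord_add]
    by_cases h1 : coeffWord P w = 0
    · rw [h1, zero_add]
      exact hQ fun h2 => hw (by rw [coeffWord_add, h1, h2, zero_add])
    · exact absurd (hP h1) h1
  | smul c P _ hP =>
    rw [coeffWord_smul]
    by_cases h1 : coeffWord P w = 0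
    · rw [h1, mul_zero]
    · exact absurd (hP h1) h1

theorem list_prod_mem_homogeneous {f : G → NC A X} {d : G → ℕ}
    (hf : ∀ g, f g ∈ homogeneous A X (d g)) (l : List G) :
    (l.map f).prod ∈ homogeneous A X (l.map d).sum := by
  induction l with
  | nil => exact word_mem_homogeneous []
  | cons g l ih =>
    rw [List.map_cons, List.map_cons, List.prod_cons, List.sum_cons]
    exact mul_mem_homogeneous (hf g) ih

theorem evalHom_bracketWord_mem_homogeneous {f : G → NC A X} {d : G → ℕ}
    (hf : ∀ g, f g ∈ homogeneous A X (d g)) (l : List G) :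
    evalHom f (bracketWord A l) ∈ homogeneous A X (l.map d).sum := by
  induction l with
  | nil => rw [bracketWord, map_zero]; exact Submodule.zero_mem _
  | cons g l ih =>
    cases l with
    | nil => simpa [bracketWord, evalHom_letter] using hf g
    | cons h l =>
      rw [bracketWord, ← AlgHom.toLieHom_apply, LieHom.map_lie, AlgHom.toLieHom_apply,
        AlgHom.toLieHom_apply, evalHom_letter, List.map_cons, List.sum_cons]
      exact lie_mem_homogeneous (hf g) ih

theorem bracketWord_mem_homogeneous (l : List X) :
    bracketWord A l ∈ homogeneous A X l.length := by
  have h := evalHom_bracketWord_mem_homogeneous (letter_mem_homogeneous (A := A) (X := X)) l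
  simpa [evalHom_letter_eq_id] using h

theorem bracketWord_mem_lieSpan (l : List X) :
    bracketWord A l ∈ LieSubalgebra.lieSpan A (NC A X) (Set.range (letter A)) := by
  induction l with
  | nil => exact LieSubalgebra.zero_mem _
  | cons g l ih =>
    cases l with
    | nil => exact LieSubalgebra.subset_lieSpan ⟨g, rfl⟩
    | cons h l => exact LieSubalgebra.lie_mem _ (LieSubalgebra.subset_lieSpan ⟨g, rfl⟩) ih

end

noncomputable section

variable {A X : Type*} [CommRing A]

/-! ### The Dynkin operator and its adjoint -/

/-- `∑_{uv = w} f(|u|) u ⧢ a(v)`. -/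
def antipodeSum (A : Type*) {X : Type*} [CommRing A] (f : ℕ → A) (w : List X) : NC A X :=
  ∑ i ∈ Finset.range (w.length + 1),
    f i • shuffle (word A (w.take i)) (antipode (word A (w.drop i)))

theorem antipode_word (w : List X) :
    antipode (word A w) = (-1 : A) ^ w.length • word A w.reverse := wordExt_word _ _

theorem constTerm_antipode (P : NC A X) : constTerm A X (antipode P) = constTerm A X P := by
  classical
  induction P using NC.induct with
  | hadd P P' h h' => simp only [map_add, h, h']
  | hsmul c P h => simp only [map_smul, h]
  | hword u => cases u <;> simp [antipode_word, constTerm_word]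

theorem leftDel_antipode_word_concat [DecidableEq X] (x z : X) (v : List X) :
    leftDel A x (antipode (word A (v ++ [z]))) = if z = x then -antipode (word A v) else 0 := by
  rw [antipode_word, antipode_word, map_smul, List.reverse_append, List.reverse_singleton,
    List.singleton_append, leftDel_word_cons, List.length_append, List.length_singleton, pow_succ]
  split_ifs <;> simp

theorem antipodeSum_nil (f : ℕ → A) : antipodeSum A f ([] : List X) = f 0 • 1 := by
  have h : antipode (1 : NC A X) = 1 := by
    simpa [word_nil] using antipode_word (A := A) ([] : List X)
  simp [antipodeSum, word_nil, h]

theorem constTerm_antipodeSum (f : ℕ → A) {w : List X} (hw : w ≠ []) :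
    constTerm A X (antipodeSum A f w) = 0 := by
  classical
  rw [antipodeSum, map_sum]
  refine Finset.sum_eq_zero fun i _ => ?_
  have : w.take i ≠ [] ∨ w.drop i ≠ [] := by
    by_contra! h
    exact hw (by rw [← List.take_append_drop i w, h.1, h.2, List.append_nil])
  rcases this with h | h <;> simp [constTerm_shuffle, constTerm_antipode, constTerm_word, h]

/-- The first letter of a term of `antipodeSum A f (y m') = antipodeSum A f (m z)` is either the
first letter `y` of `u` or the last letter `z` of `v`. -/
theorem leftDel_antipodeSum [DecidableEq X] (f : ℕ → A) (x y z : X) {m m' : List X}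
    (h : y :: m' = m ++ [z]) :
    leftDel A x (antipodeSum A f (y :: m')) =
      (if y = x then antipodeSum A (fun i => f (i + 1)) m' else 0) -
        (if z = x then antipodeSum A f m else 0) := by
  have hlen : m'.length = m.length := by simpa using congrArg List.length h
  rw [antipodeSum, map_sum]
  simp only [map_smul, leftDel_shuffle, smul_add, Finset.sum_add_distrib]
  rw [sub_eq_add_neg]
  congr 1
  · rw [List.length_cons, Finset.sum_range_succ']
    simp only [List.take_zero, word_nil, leftDel_one, map_zero, LinearMap.zero_apply, smul_zero,
      add_zero, List.take_succ_cons, List.drop_succ_cons, leftDel_word_cons]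
    split_ifs with hy
    · rfl
    · simp
  · rw [h, List.length_append, List.length_singleton, Finset.sum_range_succ,
      List.drop_eq_nil_of_le (by simp), word_nil, ← word_nil, antipode_word]
    simp only [List.reverse_nil, word_nil, map_smul, leftDel_one, smul_zero, map_zero, add_zero]
    have : ∀ i ∈ Finset.range (m.length + 1),
        f i • shuffle (word A ((m ++ [z]).take i))
          (leftDel A x (antipode (word A ((m ++ [z]).drop i)))) =
        if z = x then -(f i • shuffle (word A (m.take i)) (antipode (word A (m.drop i))))
        else 0 := by
      intro i hi
      have hi : i ≤ m.length := by simpa [Nat.lt_succ_iff] using hi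
      rw [List.take_append_of_le_length hi, List.drop_append_of_le_length hi,
        leftDel_antipode_word_concat]
      split_ifs <;> simp
    rw [Finset.sum_congr rfl this]
    split_ifs
    · rw [Finset.sum_neg_distrib, antipodeSum]
    · simp

theorem exists_eq_append_singleton (y : X) (m' : List X) : ∃ m z, y :: m' = m ++ [z] :=
  ⟨_, _, (List.dropLast_append_getLast (List.cons_ne_nil y m')).symm⟩

/-- The defining property of the antipode. -/
theorem antipodeSum_one (w : List X) (hw : w ≠ []) : antipodeSum A (fun _ => 1) w = 0 := by
  classical
  induction hk : w.length using Nat.strong_induction_on generalizing w with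
  | _ k ih =>
    refine ext_leftDel (by rw [constTerm_antipodeSum _ hw, map_zero]) fun x => ?_
    obtain ⟨y, m', rfl⟩ := List.exists_cons_of_ne_nil hw
    obtain ⟨m, z, h⟩ := exists_eq_append_singleton y m'
    have hlen : m'.length = m.length := by simpa using congrArg List.length h
    rw [leftDel_antipodeSum _ x y z h, map_zero]
    by_cases hm : m' = []
    · subst hm
      have hm0 : m = [] := List.eq_nil_of_length_eq_zero hlen.symm
      subst hm0
      obtain rfl : y = z := by simpa using h
      exact sub_self _
    · have hm' : m ≠ [] := fun h0 => hm (List.eq_nil_of_length_eq_zero (by rw [hlen, h0]; rfl))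
      rw [List.length_cons] at hk
      rw [ih _ (by omega) m' hm rfl, ih _ (by omega) m hm' rfl]
      simp

/-- `∑_{uv = w} |u| u ⧢ a(v)`. -/
def dynkinAdjWord (A : Type*) {X : Type*} [CommRing A] (w : List X) : NC A X :=
  antipodeSum A (fun i => (i : A)) w

theorem constTerm_dynkinAdjWord (w : List X) : constTerm A X (dynkinAdjWord A w) = 0 := by
  by_cases hw : w = []
  · simp [hw, dynkinAdjWord, antipodeSum_nil]
  · exact constTerm_antipodeSum _ hw

theorem leftDel_dynkinAdjWord [DecidableEq X] (x y z : X) {m m' : List X}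
    (h : y :: m' = m ++ [z]) :
    leftDel A x (dynkinAdjWord A (y :: m')) =
      (if y = x then dynkinAdjWord A m' + antipodeSum A (fun _ => 1) m' else 0) -
        (if z = x then dynkinAdjWord A m else 0) := by
  rw [dynkinAdjWord, leftDel_antipodeSum _ x y z h]
  congr 2
  simp [dynkinAdjWord, antipodeSum, add_smul, Finset.sum_add_distrib]

theorem pairing_concat_mul_letter [DecidableEq X] (m : List X) (z x : X) (Q : NC A X) :
    pairing A X (word A (m ++ [z])) (Q * letter A x) =
      if z = x then pairing A X (word A m) Q else 0 := by
  induction Q using NC.induct with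
  | hadd P P' h h' => rw [add_mul, map_add, map_add, h, h']; split_ifs <;> simp
  | hsmul c P h => rw [smul_mul_assoc, map_smul, map_smul, h]; split_ifs <;> simp
  | hword w =>
    rw [letter, ← word_append, pairing_word_word, pairing_word_word]
    by_cases h : z = x <;> simp [h]

/-- The sum `∑_{uv = w} |u| u ⧢ a(v)` is the image of `w` under the adjoint of the right normed
bracketing. -/
theorem pairing_dynkinAdjWord (w w' : List X) :
    pairing A X (dynkinAdjWord A w) (word A w') = pairing A X (word A w) (bracketWord A w') := by
  classical
  induction w' generalizing w with
  | nil => rw [word_nil, ← constTerm_apply, constTerm_dynkinAdjWord, bracketWord, map_zero]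
  | cons x w' ih =>
    cases w with
    | nil =>
      have h0 : pairing A X (word A ([] : List X)) (bracketWord A (x :: w')) = 0 := by
        rw [pairing_word_left]
        by_contra h
        simpa using length_eq_of_mem_homogeneous (bracketWord_mem_homogeneous (x :: w')) h
      rw [h0]
      simp [dynkinAdjWord, antipodeSum_nil]
    | cons y m' =>
      obtain ⟨m, z, h⟩ := exists_eq_append_singleton y m'
      rw [word_cons x, pairing_letter_mul, leftDel_dynkinAdjWord x y z h]
      cases w' with
      | nil =>
        rw [word_nil, ← constTerm_apply, map_sub, apply_ite (constTerm A X),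
          apply_ite (constTerm A X), map_add, constTerm_dynkinAdjWord, constTerm_dynkinAdjWord,
          map_zero, ite_self, sub_zero, zero_add, bracketWord, letter, pairing_word_word]
        by_cases hm : m' = []
        · simp [hm, antipodeSum_nil]
        · simp [hm, constTerm_antipodeSum]
      | cons x' w' =>
        have hN : pairing A X (antipodeSum A (fun _ => 1) m') (word A (x' :: w')) = 0 := by
          by_cases hm : m' = []
          · rw [hm, antipodeSum_nil, one_smul, ← word_nil, pairing_word_word, if_neg (by simp)]
          · rw [antipodeSum_one m' hm, map_zero, LinearMap.zero_apply]
        rw [bracketWord, LieRing.of_associative_ring_bracket, map_sub, map_sub,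
          LinearMap.sub_apply, pairing_letter_mul, leftDel_word_cons, h,
          pairing_concat_mul_letter]
        congr 1
        · split_ifs
          · rw [map_add, LinearMap.add_apply, hN, add_zero, ih]
          · rw [map_zero]
            rfl
        · split_ifs
          · rw [ih]
          · rw [map_zero, LinearMap.zero_apply]

/-- The span of the shuffle products of two polynomials without constant term. -/
def shuffleSquare (A X : Type*) [CommRing A] : Submodule A (NC A X) :=
  Submodule.span A {s | ∃ P Q, constTerm A X P = 0 ∧ constTerm A X Q = 0 ∧ s = shuffle P Q}

/-- In `∑_{uv = w} |u| u ⧢ a(v)` only the term with `v = 1` is not a shuffle product of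
polynomials without constant term, up to the coefficient `|u|`, which is `0` for `u = 1`. -/
theorem smul_word_sub_dynkinAdjWord_mem (w : List X) :
    (w.length : A) • word A w - dynkinAdjWord A w ∈ shuffleSquare A X := by
  classical
  rw [dynkinAdjWord, antipodeSum, Finset.sum_range_succ, List.take_length, List.drop_length,
    antipode_word]
  simp only [List.length_nil, pow_zero, List.reverse_nil, one_smul, word_nil, shuffle_one]
  rw [sub_add_cancel_right]
  refine Submodule.neg_mem _ (Submodule.sum_mem _ fun i hi => ?_)
  rw [Finset.mem_range] at hi
  rcases Nat.eq_zero_or_pos i with rfl | hi0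
  · simp
  · refine Submodule.smul_mem _ _ (Submodule.subset_span ⟨_, _, ?_, ?_, rfl⟩)
    · rw [constTerm_word, if_neg]
      intro h
      rcases List.take_eq_nil_iff.1 h with h | h
      · omega
      · simp [h] at hi
    · rw [constTerm_antipode, constTerm_word, if_neg]
      intro h
      exact absurd (List.drop_eq_nil_iff.1 h) (by omega)

theorem pairing_shuffleSquare {a : NC A X}
    (ha : a ∈ LieSubalgebra.lieSpan A (NC A X) (Set.range (letter A))) {P : NC A X}
    (hP : P ∈ shuffleSquare A X) : pairing A X P a = 0 := by
  induction hP using Submodule.span_induction with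
  | mem s hs =>
    obtain ⟨P, Q, hP, hQ, rfl⟩ := hs
    exact pairing_shuffle_of_mem_lieSpan ha hP hQ
  | zero => simp
  | add P Q _ _ hP hQ => simp [hP, hQ]
  | smul c P _ hP => simp [hP]

variable [Algebra ℚ A]

/-- The Dynkin projector: `w ↦ r(w) / |w|`. -/
def dynkinProj (A X : Type*) [CommRing A] [Algebra ℚ A] : NC A X →ₗ[A] NC A X :=
  wordExt fun w => algebraMap ℚ A (w.length : ℚ)⁻¹ • bracketWord A w

theorem dynkinProj_word (w : List X) : dynkinProj A X (word A w) =
    algebraMap ℚ A (w.length : ℚ)⁻¹ • bracketWord A w := wordExt_word _ _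

/-- The adjoint of the Dynkin projector. -/
def dynkinProjAdj (A X : Type*) [CommRing A] [Algebra ℚ A] : NC A X →ₗ[A] NC A X :=
  wordExt fun w => algebraMap ℚ A (w.length : ℚ)⁻¹ • dynkinAdjWord A w

theorem pairing_dynkinProjAdj (P Q : NC A X) :
    pairing A X (dynkinProjAdj A X P) Q = pairing A X P (dynkinProj A X Q) := by
  induction P using NC.induct with
  | hadd P P' h h' => simp only [map_add, LinearMap.add_apply, h, h']
  | hsmul c P h => simp only [map_smul, LinearMap.smul_apply, h]
  | hword u =>
    induction Q using NC.induct with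
    | hadd P P' h h' => simp only [map_add, h, h']
    | hsmul c P h => simp only [map_smul, h]
    | hword v =>
      rw [dynkinProjAdj, wordExt_word, dynkinProj_word, map_smul, map_smul, LinearMap.smul_apply,
        pairing_dynkinAdjWord]
      by_cases h : pairing A X (word A u) (bracketWord A v) = 0
      · simp [h]
      · rw [pairing_word_left] at h
        rw [length_eq_of_mem_homogeneous (bracketWord_mem_homogeneous v) h]

theorem dynkinProj_mem_lieSpan (P : NC A X) :
    dynkinProj A X P ∈ LieSubalgebra.lieSpan A (NC A X) (Set.range (letter A)) := by
  induction P using NC.induct with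
  | hadd P P' h h' => rw [map_add]; exact LieSubalgebra.add_mem _ h h'
  | hsmul c P h => rw [map_smul]; exact LieSubalgebra.smul_mem _ _ h
  | hword u =>
    rw [dynkinProj_word]
    exact LieSubalgebra.smul_mem _ _ (bracketWord_mem_lieSpan u)

theorem sub_dynkinProjAdj_mem {P : NC A X} (hP : constTerm A X P = 0) :
    P - dynkinProjAdj A X P ∈ shuffleSquare A X := by
  suffices P ∈ (shuffleSquare A X).comap (LinearMap.id - dynkinProjAdj A X) from this
  refine mem_of_constTerm_eq_zero hP fun x l => ?_
  have h := Submodule.smul_mem _ (algebraMap ℚ A ((x :: l).length : ℚ)⁻¹)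
    (smul_word_sub_dynkinAdjWord_mem (A := A) (x :: l))
  have hne : ((x :: l).length : ℚ) ≠ 0 := by
    simpa using Nat.cast_add_one_ne_zero (R := ℚ) l.length
  have hone : algebraMap ℚ A ((x :: l).length : ℚ)⁻¹ * ((x :: l).length : A) = 1 := by
    rw [← map_natCast (algebraMap ℚ A), ← map_mul, inv_mul_cancel₀ hne, map_one]
  rw [smul_sub, smul_smul, hone, one_smul] at h
  rw [Submodule.mem_comap, LinearMap.sub_apply, LinearMap.id_apply, dynkinProjAdj, wordExt_word]
  exact h

/-- The Dynkin–Specht–Wever theorem. -/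
theorem dynkinProj_of_mem_lieSpan {a : NC A X}
    (ha : a ∈ LieSubalgebra.lieSpan A (NC A X) (Set.range (letter A))) :
    dynkinProj A X a = a := by
  have hconst : ∀ b ∈ LieSubalgebra.lieSpan A (NC A X) (Set.range (letter A)),
      pairing A X 1 b = 0 := by
    intro b hb
    -- `1 = 1 ⧢ 1`, and the adjoint of `b` is a derivation
    have h := congrArg (constTerm A X) (adjMul_shuffle_of_mem_lieSpan hb 1 1)
    simp only [shuffle_one, one_shuffle, map_add, constTerm_adjMul] at h
    simpa using h
  refine ext_pairing_right fun w => ?_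
  cases w with
  | nil => rw [word_nil, hconst _ ha, hconst _ (dynkinProj_mem_lieSpan a)]
  | cons x w =>
    have hc : constTerm A X (word A (x :: w)) = 0 := by rw [word_cons, constTerm_letter_mul]
    have h := pairing_shuffleSquare ha (sub_dynkinProjAdj_mem hc)
    rw [map_sub, LinearMap.sub_apply, sub_eq_zero, pairing_dynkinProjAdj] at h
    exact h.symm

/-- The polynomials without constant term which are orthogonal to the Lie polynomials are the
combinations of shuffle products of polynomials without constant term. -/
theorem mem_shuffleSquare_of_forall_pairing_eq_zero {P : NC A X} (hP : constTerm A X P = 0)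
    (h : ∀ a ∈ LieSubalgebra.lieSpan A (NC A X) (Set.range (letter A)), pairing A X P a = 0) :
    P ∈ shuffleSquare A X := by
  have h0 : dynkinProjAdj A X P = 0 := ext_pairing fun w => by
    rw [pairing_dynkinProjAdj, h _ (dynkinProj_mem_lieSpan _), map_zero, LinearMap.zero_apply]
  simpa [h0] using sub_dynkinProjAdj_mem hP

end

noncomputable section

variable {A : Type*} [CommRing A] {n : ℕ}

/-! ### Duality between half-shuffles and products of generators of `I_n` -/

/-- The word `t ṽ`. -/
def revGen (A : Type*) [CommRing A] {n : ℕ} (g : Gen n) : NC A (Letters n) :=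
  word A (g.2.1 :: outerWord g.1.reverse)

theorem revGen_eq (g : Gen n) :
    revGen A g = letter A g.2.1 * word A (outerWord g.1.reverse) := word_cons _ _

theorem constTerm_revGen (g : Gen n) : constTerm A (Letters n) (revGen A g) = 0 := by
  rw [revGen_eq, constTerm_letter_mul]

theorem outer_ne_inner (x : Outer n) (t : Inner n) : x.1 ≠ t.1 := fun h => by
  have h1 := x.2
  have h2 := t.2
  rw [← h, h1] at h2
  exact lt_irrefl _ h2

theorem adGen_cons (x : Outer n) (v : List (Outer n)) (t : Inner n) :
    adGen A (x :: v, t) = adGen A (v, t) * letter A x.1 - letter A x.1 * adGen A (v, t) := by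
  change ⁅-letter A x.1, adGen A (v, t)⁆ = _
  rw [LieRing.of_associative_ring_bracket]
  noncomm_ring

theorem leftDel_outerWord (x : Letters n) (u : List (Outer n)) :
    leftDel A x (word A (outerWord u)) = 0 ∨
      ∃ u', leftDel A x (word A (outerWord u)) = word A (outerWord u') := by
  classical
  cases u with
  | nil => exact Or.inl (leftDel_one x)
  | cons y u =>
    rw [outerWord, List.map_cons, leftDel_word_cons]
    by_cases h : y.1 = x
    · exact Or.inr ⟨u, if_pos h⟩
    · exact Or.inl (if_neg h)

theorem adjMul_adGen_outerWord (g : Gen n) (u : List (Outer n)) :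
    adjMul A (Letters n) (adGen A g) (word A (outerWord u)) = 0 := by
  classical
  obtain ⟨v, t⟩ := g
  induction v generalizing u with
  | nil =>
    change adjMul A (Letters n) (letter A t.1) _ = 0
    rw [adjMul_letter]
    cases u with
    | nil => exact leftDel_one _
    | cons y u =>
      rw [outerWord, List.map_cons, leftDel_word_cons, if_neg (outer_ne_inner y t)]
  | cons x v ih =>
    rw [adGen_cons, map_sub, adjMul_mul, adjMul_mul, adjMul_letter, LinearMap.sub_apply,
      LinearMap.comp_apply, LinearMap.comp_apply, ih, map_zero, zero_sub, neg_eq_zero]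
    rcases leftDel_outerWord (A := A) x.1 u with h | ⟨u', h⟩
    · rw [h, map_zero]
    · rw [h, ih]

/-- The adjoint of multiplication by a generator of `I_n` is a derivation of the shuffle product
which vanishes on the words over `T_n`, so it commutes with the shuffle by such a word. -/
theorem pairing_shuffle_adGen_mul (u : List (Outer n)) (g : Gen n) (P R : NC A (Letters n)) :
    pairing A _ (shuffle (word A (outerWord u)) P) (adGen A g * R) =
      pairing A _ (shuffle (word A (outerWord u)) (adjMul A _ (adGen A g) P)) R := by
  rw [pairing_mul, adjMul_shuffle_of_mem_lieSpan (adGen_mem_freeLie A g), adjMul_adGen_outerWord,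
    map_zero, LinearMap.zero_apply, zero_add]

theorem pairing_shuffle_prod_adGen (u : List (Outer n)) (hu : u ≠ []) (l : List (Gen n))
    (P : NC A (Letters n)) :
    pairing A _ (shuffle (word A (outerWord u)) P) (l.map (adGen A)).prod = 0 := by
  classical
  induction l generalizing P with
  | nil =>
    rw [List.map_nil, List.prod_nil, ← constTerm_apply, constTerm_shuffle, constTerm_word,
      if_neg (by simpa [outerWord] using hu), zero_mul]
  | cons g l ih => rw [List.map_cons, List.prod_cons, pairing_shuffle_adGen_mul, ih]

/-- The part of `(ad_{-v} t) R` that begins with a letter of `𝒯_{n-1}` is `t ṽ R`. -/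
theorem pairing_inner_mul_adGen_mul [DecidableEq (Inner n)] (t : Inner n) (g : Gen n)
    (S R : NC A (Letters n)) :
    pairing A _ (letter A t.1 * S) (adGen A g * R) =
      if t = g.2 then pairing A _ S (word A (outerWord g.1.reverse) * R) else 0 := by
  classical
  obtain ⟨v, t'⟩ := g
  induction v generalizing R with
  | nil =>
    change pairing A _ _ (letter A t'.1 * R) = _
    rw [pairing_letter_mul, leftDel_letter_mul]
    simp only [Subtype.coe_inj, List.reverse_nil]
    split_ifs
    · change _ = pairing A _ S (1 * R)
      rw [one_mul]
    · simp
  | cons x v ih =>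
    rw [adGen_cons, sub_mul, mul_assoc, mul_assoc, map_sub, ih, pairing_letter_mul,
      leftDel_letter_mul, if_neg (outer_ne_inner x t).symm, map_zero, LinearMap.zero_apply,
      sub_zero, List.reverse_cons]
    simp only [outerWord, List.map_append, word_append, mul_assoc]
    rfl

theorem pairing_one_adGen_mul (g : Gen n) (R : NC A (Letters n)) :
    pairing A _ 1 (adGen A g * R) = 0 := by
  obtain ⟨v, t⟩ := g
  induction v generalizing R with
  | nil =>
    change pairing A _ _ (letter A t.1 * R) = _
    rw [pairing_letter_mul, leftDel_one, map_zero, LinearMap.zero_apply]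
  | cons x v ih =>
    rw [adGen_cons, sub_mul, mul_assoc, mul_assoc, map_sub, ih, pairing_letter_mul, leftDel_one,
      map_zero, LinearMap.zero_apply, sub_zero]

theorem iterHalfShuffle_revGen_cons (g : Gen n) (l : List (Gen n)) :
    iterHalfShuffle ((g :: l).map (revGen A)) = letter A g.2.1 *
      shuffle (word A (outerWord g.1.reverse)) (iterHalfShuffle (l.map (revGen A))) := by
  change halfShuffle (revGen A g) (iterHalfShuffle (l.map (revGen A))) = _
  rw [revGen_eq, letter_mul_halfShuffle]

theorem leftDel_outer_iterHalfShuffle (x : Outer n) (l : List (Gen n)) :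
    leftDel A x.1 (iterHalfShuffle (l.map (revGen A))) = 0 := by
  classical
  cases l with
  | nil => exact leftDel_one _
  | cons g l =>
    rw [iterHalfShuffle_revGen_cons, leftDel_letter_mul, if_neg (outer_ne_inner x g.2).symm]

theorem pairing_shuffle_iterHalfShuffle_word_mul [DecidableEq (List (Outer n))]
    (u v : List (Outer n)) (l m : List (Gen n)) :
    pairing A _ (shuffle (word A (outerWord u)) (iterHalfShuffle (l.map (revGen A))))
        (word A (outerWord v) * (m.map (adGen A)).prod) =
      if u = v then
        pairing A _ (iterHalfShuffle (l.map (revGen A))) (m.map (adGen A)).prod else 0 := by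
  classical
  induction v generalizing u with
  | nil =>
    change pairing A _ _ (1 * _) = _
    rw [one_mul]
    split_ifs with h
    · subst h
      change pairing A _ (shuffle 1 _) _ = _
      rw [one_shuffle]
    · exact pairing_shuffle_prod_adGen u h m _
  | cons y v ih =>
    change pairing A _ _ (word A (y.1 :: outerWord v) * _) = _
    rw [word_cons, mul_assoc, pairing_letter_mul, leftDel_shuffle, leftDel_outer_iterHalfShuffle,
      map_zero, add_zero]
    cases u with
    | nil =>
      change pairing A _ (shuffle (leftDel A y.1 1) _) _ = _
      simp
    | cons x u =>
      rw [outerWord, List.map_cons, leftDel_word_cons]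
      by_cases h : x = y
      · subst h
        rw [if_pos rfl, ← outerWord, ih]
        simp
      · rw [if_neg fun h' => h (Subtype.ext h'), map_zero, if_neg (by simp [h])]
        simp

/-- Duality between the iterated half-shuffles of the `t ṽ` and the products of the
`ad_{-v} t`. -/
theorem pairing_iterHalfShuffle_prod [DecidableEq (List (Gen n))] (l m : List (Gen n)) :
    pairing A _ (iterHalfShuffle (l.map (revGen A))) (m.map (adGen A)).prod =
      if l = m then 1 else 0 := by
  classical
  induction l generalizing m with
  | nil =>
    change pairing A _ 1 _ = _
    cases m with
    | nil => simpa [constTerm_apply] using constTerm_one (A := A) (X := Letters n)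
    | cons h m => rw [List.map_cons, List.prod_cons, pairing_one_adGen_mul, if_neg (by simp)]
  | cons g l ih =>
    rw [iterHalfShuffle_revGen_cons]
    cases m with
    | nil =>
      rw [List.map_nil, List.prod_nil, ← constTerm_apply, constTerm_letter_mul, if_neg (by simp)]
    | cons h m =>
      rw [List.map_cons, List.prod_cons, pairing_inner_mul_adGen_mul,
        pairing_shuffle_iterHalfShuffle_word_mul, ih]
      obtain ⟨v, t⟩ := g
      obtain ⟨v', t'⟩ := h
      simp only [List.reverse_inj, List.cons.injEq, Prod.mk.injEq]
      by_cases h1 : t = t' <;> by_cases h2 : v = v' <;> simp [h1, h2]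

theorem pairing_shuffle_iterHalfShuffle [DecidableEq (List (Outer n) × List (Gen n))]
    (i j : List (Outer n) × List (Gen n)) :
    pairing A _ (shuffle (word A (outerWord i.1)) (iterHalfShuffle (i.2.map (revGen A))))
        (word A (outerWord j.1) * (j.2.map (adGen A)).prod) = if i = j then 1 else 0 := by
  classical
  rw [pairing_shuffle_iterHalfShuffle_word_mul, pairing_iterHalfShuffle_prod]
  obtain ⟨u, l⟩ := i
  obtain ⟨v, m⟩ := j
  by_cases h1 : u = v <;> by_cases h2 : l = m <;> simp [h1, h2]

theorem pairing_zinbielHom_evalHom (P Q : NC A (Gen n)) :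
    pairing A (Letters n) (zinbielHom (revGen A) P) (evalHom (adGen A) Q) =
      pairing A (Gen n) P Q := by
  classical
  induction P using NC.induct with
  | hadd P P' h h' => simp only [map_add, LinearMap.add_apply, h, h']
  | hsmul c P h => simp only [map_smul, LinearMap.smul_apply, h]
  | hword u =>
    induction Q using NC.induct with
    | hadd P P' h h' => simp only [map_add, h, h']
    | hsmul c P h => simp only [map_smul, h]
    | hword v =>
      rw [zinbielHom_word, evalHom_word, pairing_iterHalfShuffle_prod, pairing_word_word]
      congr

/-- The words over `T_n` times the products of the `ad_{-v} t` span all polynomials: letters of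
`T_n` are moved to the left by `(ad_{-v} t) x = x (ad_{-v} t) + ad_{-xv} t`. -/
theorem span_word_mul_prod_adGen :
    Submodule.span A (Set.range fun i : List (Outer n) × List (Gen n) =>
      word A (outerWord i.1) * (i.2.map (adGen A)).prod) = ⊤ := by
  set N := Submodule.span A (Set.range fun i : List (Outer n) × List (Gen n) =>
      word A (outerWord i.1) * (i.2.map (adGen A)).prod) with hN
  have hmem : ∀ (w : List (Outer n)) (l : List (Gen n)),
      word A (outerWord w) * (l.map (adGen A)).prod ∈ N := fun w l =>
    Submodule.subset_span ⟨(w, l), rfl⟩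
  have hstable : ∀ a : NC A (Letters n),
      (∀ (w : List (Outer n)) (l : List (Gen n)),
        a * (word A (outerWord w) * (l.map (adGen A)).prod) ∈ N) → ∀ P ∈ N, a * P ∈ N := by
    intro a ha P hP
    suffices N ≤ N.comap (LinearMap.mulLeft A a) from this hP
    conv_lhs => rw [hN]
    rw [Submodule.span_le]
    rintro _ ⟨⟨w, l⟩, rfl⟩
    exact ha w l
  have houter : ∀ (x : Outer n), ∀ P ∈ N, letter A x.1 * P ∈ N := fun x =>
    hstable _ fun w l => by
      rw [← mul_assoc, ← word_cons]
      exact hmem (x :: w) l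
  have hinner : ∀ (w : List (Outer n)) (l : List (Gen n)) (g : Gen n),
      adGen A g * (word A (outerWord w) * (l.map (adGen A)).prod) ∈ N := by
    intro w l
    induction w with
    | nil =>
      intro g
      change _ * (1 * _) ∈ N
      rw [one_mul, ← List.prod_cons, ← List.map_cons]
      have := hmem [] (g :: l)
      rwa [outerWord, List.map_nil, word_nil, one_mul] at this
    | cons x w ih =>
      rintro ⟨v, t⟩
      have h : adGen A (v, t) * letter A x.1 =
          letter A x.1 * adGen A (v, t) + adGen A (x :: v, t) := by
        rw [adGen_cons, add_sub_cancel]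
      change _ * (word A (x.1 :: outerWord w) * _) ∈ N
      rw [word_cons, mul_assoc, ← mul_assoc, h, add_mul, mul_assoc]
      exact N.add_mem (houter x _ (ih _)) (ih _)
  have hletter : ∀ (x : Letters n), ∀ P ∈ N, letter A x * P ∈ N := by
    intro x
    rcases lt_or_eq_of_le x.2.2.2 with h | h
    · exact hstable _ fun w l => hinner w l ([], ⟨x, h⟩)
    · exact houter ⟨x, h⟩
  rw [eq_top_iff]
  intro P _
  induction P using NC.induct with
  | hadd P P' h h' => exact N.add_mem (h trivial) (h' trivial)
  | hsmul c P h => exact N.smul_mem c (h trivial)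
  | hword w =>
    induction w with
    | nil => simpa [outerWord, word_nil] using hmem [] []
    | cons x w ih => rw [word_cons]; exact hletter x _ (ih trivial)

theorem adGen_mem_homogeneous (g : Gen n) :
    adGen A g ∈ homogeneous A (Letters n) (g.1.length + 1) := by
  obtain ⟨v, t⟩ := g
  induction v with
  | nil => exact letter_mem_homogeneous t.1
  | cons x v ih =>
    have h := lie_mem_homogeneous (Submodule.neg_mem _ (letter_mem_homogeneous (A := A) x.1)) ih
    rwa [add_comm] at h

theorem rightBracket_word {X : Type*} (w : List X) : rightBracket (word A w) = bracketWord A w :=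
  wordExt_word _ _

theorem bracketWord_genWord (g : Gen n) :
    bracketWord A (genWord g) = (-1 : A) ^ g.1.length • adGen A g := by
  obtain ⟨v, t⟩ := g
  induction v with
  | nil => simp [genWord, outerWord, bracketWord, adGen]
  | cons x v ih =>
    have h : bracketWord A (genWord (x :: v, t)) =
        ⁅letter A x.1, bracketWord A (genWord (v, t))⁆ := by
      cases v <;> rfl
    have h' : adGen A (x :: v, t) = ⁅-letter A x.1, adGen A (v, t)⁆ := rfl
    rw [h, ih, h', lie_smul, neg_lie, List.length_cons, pow_succ, mul_neg_one, neg_smul_neg]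

theorem rGen_eq (g : Gen n) : rGen A g = (-1 : A) ^ g.1.length • adGen A g := by
  rw [rGen, rightBracket_word, bracketWord_genWord]

theorem adGen_eq (g : Gen n) : adGen A g = (-1 : A) ^ g.1.length • rGen A g := by
  rw [rGen_eq, smul_smul, ← mul_pow, neg_one_mul, neg_neg, one_pow, one_smul]

theorem aGen_eq (g : Gen n) : aGen A g = (-1 : A) ^ (g.1.length + 1) • revGen A g := by
  rw [aGen, antipode_word, genWord, revGen]
  simp [outerWord]

theorem tuGen_eq (g : Gen n) : tuGen A g = (-1 : A) • revGen A g := by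
  rw [revGen_eq, neg_one_smul]
  rfl

theorem tuGen_eq_aGen (g : Gen n) : tuGen A g = (-1 : A) ^ g.1.length • aGen A g := by
  rw [aGen_eq, tuGen_eq, smul_smul, pow_succ, ← mul_assoc, ← mul_pow, neg_one_mul, neg_neg,
    one_pow, one_mul]

theorem aGen_eq_tuGen (g : Gen n) : aGen A g = (-1 : A) ^ g.1.length • tuGen A g := by
  rw [tuGen_eq_aGen, smul_smul, ← mul_pow, neg_one_mul, neg_neg, one_pow, one_smul]

theorem revGen_eq_aGen (g : Gen n) : revGen A g = (-1 : A) ^ (g.1.length + 1) • aGen A g := by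
  rw [aGen_eq, smul_smul, ← mul_pow, neg_one_mul, neg_neg, one_pow, one_smul]

end

noncomputable section

variable {A X : Type*} [CommRing A]

/-! ### Graded duals -/

theorem linearIndependent_of_dual {ι M : Type*} [DecidableEq ι] [AddCommGroup M] [Module A M]
    {v : ι → M} {f : ι → Module.Dual A M} {ε : ι → A} (hε : ∀ i, ε i * ε i = 1)
    (h : ∀ i j, f i (v j) = if i = j then ε i else 0) : LinearIndependent A v := by
  refine LinearIndependent.of_pairwise_dual_eq_zero_one v (fun i => ε i • f i) ?_ ?_
  · intro i j hij
    simp [h, hij]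
  · intro i
    simp [h, hε]

theorem pairingForm_apply {M : Type*} [AddCommGroup M] [Module A M] (φ : M →ₗ[A] NC A X)
    (P : NC A X) (m : M) : pairingForm φ P m = pairing A X P (φ m) := rfl

/-- The form defined by a polynomial vanishes on the polynomials of large order. -/
theorem exists_pairing_eq_zero_of_le_length (P : NC A X) :
    ∃ N : ℕ, ∀ Q : NC A X, (∀ w, coeffWord Q w ≠ 0 → N ≤ w.length) → pairing A X P Q = 0 := by
  induction P using NC.induct with
  | hadd P P' h h' =>
    obtain ⟨N, hN⟩ := h
    obtain ⟨N', hN'⟩ := h'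
    refine ⟨max N N', fun Q hQ => ?_⟩
    rw [map_add, LinearMap.add_apply, hN Q fun w hw => le_trans (le_max_left _ _) (hQ w hw),
      hN' Q fun w hw => le_trans (le_max_right _ _) (hQ w hw), add_zero]
  | hsmul c P h =>
    obtain ⟨N, hN⟩ := h
    exact ⟨N, fun Q hQ => by rw [map_smul, LinearMap.smul_apply, hN Q hQ, smul_zero]⟩
  | hword u =>
    refine ⟨u.length + 1, fun Q hQ => ?_⟩
    rw [pairing_word_left]
    by_contra h
    exact absurd (hQ u h) (by omega)

theorem pairingForm_mem_gradedDual {M : Type*} [AddCommGroup M] [Module A M]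
    (φ : M →ₗ[A] NC A X) (P : NC A X) : pairingForm φ P ∈ gradedDual φ := by
  obtain ⟨N, hN⟩ := exists_pairing_eq_zero_of_le_length P
  exact ⟨N, fun m hm => hN (φ m) hm⟩

section DualFamily

variable {ι M : Type*} [DecidableEq ι] [AddCommGroup M] [Module A M] {φ : M →ₗ[A] NC A X}
  {e : Module.Basis ι A M} {f : ι → NC A X} {ε : ι → A} {d : ι → ℕ}

/-- A linear form which vanishes on all but finitely many elements of a basis is represented by a
combination of any family that is dual to the basis up to signs `ε`. -/
theorem eq_pairingForm_of_finite (hε : ∀ i, ε i * ε i = 1)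
    (h : ∀ i j, pairing A X (f i) (φ (e j)) = if i = j then ε i else 0)
    {F : Module.Dual A M} {s : Set ι} (hs : s.Finite)
    (hF : ∀ i ∉ s, F (e i) = 0) :
    ∃ P ∈ Submodule.span A (Set.range f), pairingForm φ P = F := by
  classical
  refine ⟨∑ i ∈ hs.toFinset, (ε i * F (e i)) • f i, Submodule.sum_mem _ fun i _ =>
    Submodule.smul_mem _ _ (Submodule.subset_span ⟨i, rfl⟩), e.ext fun j => ?_⟩
  rw [map_sum, LinearMap.sum_apply]
  simp only [map_smul, LinearMap.smul_apply, pairingForm_apply, h, smul_eq_mul, mul_ite, mul_zero,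
    Finset.sum_ite_eq', Set.Finite.mem_toFinset]
  split_ifs with hj
  · rw [mul_right_comm, hε, one_mul]
  · exact (hF j hj).symm

theorem linearIndependent_pairingForm (hε : ∀ i, ε i * ε i = 1)
    (h : ∀ i j, pairing A X (f i) (φ (e j)) = if i = j then ε i else 0) :
    LinearIndependent A fun i => pairingForm φ (f i) := by
  refine linearIndependent_of_dual (f := fun i => Module.Dual.eval A M (e i)) hε fun i j => ?_
  rw [Module.Dual.eval_apply, pairingForm_apply, h]
  by_cases hij : i = j
  · subst hij; rfl
  · rw [if_neg hij, if_neg fun h => hij h.symm]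

theorem injOn_pairingForm (hε : ∀ i, ε i * ε i = 1)
    (h : ∀ i j, pairing A X (f i) (φ (e j)) = if i = j then ε i else 0) :
    Set.InjOn (pairingForm φ) (Submodule.span A (Set.range f)) :=
  LinearMap.injOn_of_disjoint_ker le_rfl
    (Submodule.range_ker_disjoint (linearIndependent_pairingForm hε h))

/-- If the elements of a basis are homogeneous, finitely many in each degree, then a dual
family spans the graded dual. -/
theorem map_pairingForm_span (hε : ∀ i, ε i * ε i = 1)
    (h : ∀ i j, pairing A X (f i) (φ (e j)) = if i = j then ε i else 0)
    (hd : ∀ i, φ (e i) ∈ homogeneous A X (d i)) (hfin : ∀ N, {i | d i < N}.Finite) :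
    (Submodule.span A (Set.range f)).map (pairingForm φ) = gradedDual φ := by
  refine le_antisymm ?_ fun F hF => ?_
  · rintro _ ⟨P, -, rfl⟩
    exact pairingForm_mem_gradedDual φ P
  · obtain ⟨N, hN⟩ := hF
    refine eq_pairingForm_of_finite hε h (hfin N) fun i hi => hN _ fun w hw => ?_
    rw [length_eq_of_mem_homogeneous (hd i) hw]
    exact not_lt.1 hi

theorem exists_basis_gradedDual (hε : ∀ i, ε i * ε i = 1)
    (h : ∀ i j, pairing A X (f i) (φ (e j)) = if i = j then ε i else 0)
    (hd : ∀ i, φ (e i) ∈ homogeneous A X (d i)) (hfin : ∀ N, {i | d i < N}.Finite) :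
    ∃ b : Module.Basis ι A (gradedDual φ),
      ∀ i, (b i : Module.Dual A M) = pairingForm φ (f i) := by
  let v : ι → gradedDual φ := fun i => ⟨pairingForm φ (f i), pairingForm_mem_gradedDual φ _⟩
  have hli : LinearIndependent A v :=
    LinearIndependent.of_comp (gradedDual φ).subtype (linearIndependent_pairingForm hε h)
  have hspan : ⊤ ≤ Submodule.span A (Set.range v) := by
    rintro F -
    have hF := (map_pairingForm_span hε h hd hfin).ge F.2
    rw [Submodule.map_span, ← Set.range_comp] at hF
    rw [show Set.range (pairingForm φ ∘ f) = Set.range ((gradedDual φ).subtype ∘ v) from rfl,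
      Set.range_comp, ← Submodule.map_span] at hF
    obtain ⟨F', hF', h'⟩ := hF
    rwa [← (Subtype.ext h' : F' = F)]
  exact ⟨Module.Basis.mk hli hspan, fun i => by rw [Module.Basis.mk_apply]⟩

end DualFamily

theorem finite_list_sum_lt {G : Type*} {d : G → ℕ} (hd : ∀ g, 0 < d g)
    (hfin : ∀ N, {g | d g < N}.Finite) (N : ℕ) : {l : List G | (l.map d).sum < N}.Finite := by
  have : Finite {g | d g < N} := hfin N
  refine ((List.finite_length_lt {g | d g < N} N).image (List.map Subtype.val)).subset ?_
  intro l hl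
  have h1 : ∀ g ∈ l, g ∈ {g | d g < N} := fun g hg => by
    have h : d g ≤ (l.map d).sum := List.le_sum_of_mem (List.mem_map_of_mem hg)
    exact lt_of_le_of_lt h hl
  have h2 : l.length ≤ (l.map d).sum := by
    rw [← List.length_map (f := d)]
    refine List.length_le_sum_of_one_le _ fun i hi => ?_
    obtain ⟨g, -, rfl⟩ := List.mem_map.1 hi
    exact hd g
  refine ⟨l.attach.map fun g => ⟨g.1, h1 g.1 g.2⟩, ?_, ?_⟩
  · rw [Set.mem_ofPred_eq, List.length_map, List.length_attach]
    exact lt_of_le_of_lt h2 hl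
  · simp

instance (n : ℕ) : Finite (Letters n) := by
  refine Set.Finite.to_subtype (((Set.finite_Iic n).prod (Set.finite_Iic n)).subset ?_)
  rintro ⟨i, j⟩ ⟨-, h, h'⟩
  exact ⟨h.le.trans h', h'⟩

theorem finite_gen_lt (n N : ℕ) : {g : Gen n | g.1.length + 1 < N}.Finite :=
  ((List.finite_length_lt (Outer n) N).prod Set.finite_univ).subset fun _ hg =>
    ⟨lt_of_le_of_lt (Nat.le_succ _) hg, trivial⟩

/-- The basis of words. -/
theorem exists_basis_word (A X : Type*) [CommRing A] :
    ∃ b : Module.Basis (List X) A (NC A X), ∀ w, b w = word A w := by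
  classical
  have hli : LinearIndependent A (word A (X := X)) :=
    linearIndependent_of_dual (f := fun w => pairing A X (word A w)) (ε := fun _ => 1)
      (by simp) fun u v => pairing_word_word u v
  refine ⟨Module.Basis.mk hli fun P _ => ?_, fun w => by rw [Module.Basis.mk_apply]⟩
  induction P using NC.induct with
  | hadd P P' h h' => exact Submodule.add_mem _ (h trivial) (h' trivial)
  | hsmul c P h => exact Submodule.smul_mem _ c (h trivial)
  | hword w => exact Submodule.subset_span ⟨w, rfl⟩

theorem span_range_word : Submodule.span A (Set.range (word A (X := X))) = ⊤ := by
  obtain ⟨b, hb⟩ := exists_basis_word A X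
  rw [← b.span_eq]
  congr
  exact (funext hb).symm

/-! ### Enveloping algebras -/

section Enveloping

variable {G : Type*} {f : G → NC A X} {L : LieSubalgebra A (NC A X)}

theorem envMap_evalHom {a : G → L} (ha : ∀ g, (a g : NC A X) = f g) (P : NC A G) :
    envMap L (evalHom (fun g => UniversalEnvelopingAlgebra.ι A (a g)) P) = evalHom f P := by
  rw [evalHom_comp_evalHom]
  congr 2
  funext g
  rw [envMap, UniversalEnvelopingAlgebra.lift_ι_apply]
  exact ha g

/-- The enveloping algebra of a Lie algebra is generated by the generators of the Lie algebra. -/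
theorem evalHom_ι_surjective (hL : L = LieSubalgebra.lieSpan A (NC A X) (Set.range f))
    {a : G → L} (ha : ∀ g, (a g : NC A X) = f g) :
    Function.Surjective (evalHom (A := A) fun g => UniversalEnvelopingAlgebra.ι A (a g)) := by
  set S := (evalHom (A := A) fun g => UniversalEnvelopingAlgebra.ι A (a g)).range with hS
  have hmem : ∀ (x : NC A X) (_ : x ∈ LieSubalgebra.lieSpan A (NC A X) (Set.range f))
      (hx : x ∈ L), UniversalEnvelopingAlgebra.ι A (⟨x, hx⟩ : L) ∈ S := by
    intro x hx
    induction hx using LieSubalgebra.lieSpan_induction with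
    | mem x hx =>
      intro hx'
      obtain ⟨g, rfl⟩ := hx
      refine ⟨letter A g, (evalHom_letter _ g).trans ?_⟩
      congr 1
      exact Subtype.ext (ha g)
    | zero =>
      intro hx'
      have : (⟨0, hx'⟩ : L) = 0 := rfl
      rw [this, map_zero]
      exact S.zero_mem
    | add x y hx hy ihx ihy =>
      intro hxy
      have : (⟨x + y, hxy⟩ : L) = ⟨x, hL ▸ hx⟩ + ⟨y, hL ▸ hy⟩ := rfl
      rw [this, map_add]
      exact S.add_mem (ihx _) (ihy _)
    | smul c x hx ihx =>
      intro hcx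
      have : (⟨c • x, hcx⟩ : L) = c • ⟨x, hL ▸ hx⟩ := rfl
      rw [this, map_smul]
      exact S.smul_mem (ihx _) c
    | lie x y hx hy ihx ihy =>
      intro hxy
      have : (⟨⁅x, y⁆, hxy⟩ : L) = ⁅(⟨x, hL ▸ hx⟩ : L), (⟨y, hL ▸ hy⟩ : L)⁆ := rfl
      rw [this, LieHom.map_lie, LieRing.of_associative_ring_bracket]
      exact S.sub_mem (S.mul_mem (ihx _) (ihy _)) (S.mul_mem (ihy _) (ihx _))
  let ψ : L →ₗ⁅A⁆ S :=
    { toFun := fun x => ⟨UniversalEnvelopingAlgebra.ι A x, hmem x.1 (hL ▸ x.2) x.2⟩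
      map_add' := fun x y => Subtype.ext (map_add _ x y)
      map_smul' := fun c x => Subtype.ext (map_smul _ c x)
      map_lie' := fun {x y} => Subtype.ext
        ((LieHom.map_lie (UniversalEnvelopingAlgebra.ι A) x y).trans
          (LieRing.of_associative_ring_bracket _ _)) }
  have hid : S.val.comp (UniversalEnvelopingAlgebra.lift A ψ) =
      AlgHom.id A (UniversalEnvelopingAlgebra A L) := by
    refine UniversalEnvelopingAlgebra.hom_ext A (LieHom.ext fun x => ?_)
    change ((UniversalEnvelopingAlgebra.lift A ψ (UniversalEnvelopingAlgebra.ι A x) : S) :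
      UniversalEnvelopingAlgebra A L) = UniversalEnvelopingAlgebra.ι A x
    rw [UniversalEnvelopingAlgebra.lift_ι_apply]
    rfl
  intro y
  have h : ((UniversalEnvelopingAlgebra.lift A ψ y : S) : UniversalEnvelopingAlgebra A L) = y :=
    DFunLike.congr_fun hid y
  obtain ⟨P, hP⟩ := (UniversalEnvelopingAlgebra.lift A ψ y).2
  exact ⟨P, hP.trans h⟩

end Enveloping

end

noncomputable section

variable {A : Type*} [CommRing A] {n : ℕ}

/-! ### The Lie algebra `I_n` and its graded dual -/

theorem lieI_eq_lieSpan_rGen :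
    lieI A n = LieSubalgebra.lieSpan A (NC A (Letters n)) (Set.range (rGen A)) :=
  le_antisymm (lieSpan_range_le adGen_eq) (lieSpan_range_le rGen_eq)

theorem lieI_le_freeLie : lieI A n ≤ freeLie A n := by
  refine LieSubalgebra.lieSpan_le.2 ?_
  rintro _ ⟨g, rfl⟩
  exact adGen_mem_freeLie A g

theorem zinbielSpan_aGen : zinbielSpan (Set.range (aGen A (n := n))) =
    (LinearMap.ker (constTerm A (Gen n))).map (zinbielHom (revGen A)) := by
  rw [← zinbielSpan_range constTerm_revGen]
  exact le_antisymm (zinbielSpan_range_le aGen_eq) (zinbielSpan_range_le revGen_eq_aGen)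

theorem mem_lieI_iff {a : NC A (Letters n)} : a ∈ lieI A n ↔
    ∃ b ∈ LieSubalgebra.lieSpan A (NC A (Gen n)) (Set.range (letter A)),
      evalHom (adGen A) b = a := by
  rw [lieI, ← map_evalHom_lieSpan]
  rfl

theorem constTerm_of_mem_zinbielSpan_aGen {p : NC A (Letters n)}
    (hp : p ∈ zinbielSpan (Set.range (aGen A (n := n)))) : constTerm A _ p = 0 := by
  rw [zinbielSpan_aGen] at hp
  obtain ⟨P, hP, rfl⟩ := hp
  rw [constTerm_zinbielHom]
  exact hP

theorem shuffle_mem_zinbielSpan_aGen {p q : NC A (Letters n)}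
    (hp : p ∈ zinbielSpan (Set.range (aGen A (n := n))))
    (hq : q ∈ zinbielSpan (Set.range (aGen A (n := n)))) :
    shuffle p q ∈ zinbielSpan (Set.range (aGen A (n := n))) := by
  rw [shuffle_eq_halfShuffle_add, constTerm_of_mem_zinbielSpan_aGen hp, zero_mul, zero_smul,
    add_zero]
  exact Submodule.add_mem _ (halfShuffle_mem_zinbielSpan hp hq)
    (halfShuffle_mem_zinbielSpan hq hp)

theorem finite_weight_lt (n N : ℕ) :
    {l : List (Gen n) | (l.map fun g => g.1.length + 1).sum < N}.Finite :=
  finite_list_sum_lt (fun _ => Nat.succ_pos _) (finite_gen_lt n) N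

/-- A form on `I_n` is extended to the free algebra on the generators through the Dynkin
projector; this extension is represented by a combination of iterated half-shuffles. -/
theorem map_pairingForm_zinbielSpan [Algebra ℚ A] :
    (zinbielSpan (Set.range (aGen A (n := n)))).map
        (pairingForm (lieI A n).toSubmodule.subtype) =
      gradedDual (lieI A n).toSubmodule.subtype := by
  have := Classical.decEq (List (Gen n))
  refine le_antisymm ?_ fun F hF => ?_
  · rintro _ ⟨P, -, rfl⟩
    exact pairingForm_mem_gradedDual _ P
  obtain ⟨N, hN⟩ := hF
  let D : NC A (Gen n) →ₗ[A] (lieI A n).toSubmodule :=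
    LinearMap.codRestrict _ ((evalHom (adGen A)).toLinearMap ∘ₗ dynkinProj A (Gen n)) fun P =>
      mem_lieI_iff.2 ⟨_, dynkinProj_mem_lieSpan P, rfl⟩
  have hD : ∀ P, ((D P : (lieI A n).toSubmodule) : NC A (Letters n)) =
    evalHom (adGen A) (dynkinProj A (Gen n) P) := fun P => rfl
  obtain ⟨e, he⟩ := exists_basis_word A (Gen n)
  have hpair : ∀ l m, pairing A (Letters n) (iterHalfShuffle (l.map (revGen A)))
      ((evalHom (adGen A)).toLinearMap (e m)) = if l = m then 1 else 0 := fun l m => by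
    rw [he, AlgHom.toLinearMap_apply, evalHom_word, pairing_iterHalfShuffle_prod]
  obtain ⟨P, hP, hPF⟩ := eq_pairingForm_of_finite (F := F ∘ₗ D) (ε := fun _ => 1)
    (fun _ => one_mul 1) hpair (finite_weight_lt n N) fun l hl => by
      refine hN _ fun w hw => ?_
      rw [Submodule.subtype_apply, hD, he, dynkinProj_word, map_smul] at hw
      rw [length_eq_of_mem_homogeneous (Submodule.smul_mem _ _
        (evalHom_bracketWord_mem_homogeneous adGen_mem_homogeneous l)) hw]
      exact not_lt.1 hl
  rw [← range_zinbielHom] at hP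
  obtain ⟨ζ, rfl⟩ := hP
  have hrep : ∀ Q, pairing A _ (zinbielHom (revGen A) ζ) (evalHom (adGen A) Q) = F (D Q) :=
    fun Q => LinearMap.congr_fun hPF Q
  refine ⟨zinbielHom (revGen A) ζ, ?_, LinearMap.ext fun m => ?_⟩
  · rw [zinbielSpan_aGen]
    refine ⟨ζ, ?_, rfl⟩
    have hD1 : D 1 = 0 := Subtype.ext (by
      rw [hD, ← word_nil, dynkinProj_word, bracketWord, smul_zero, map_zero]
      rfl)
    have h1 := hrep 1
    rw [hD1, map_zero, map_one, ← constTerm_apply, constTerm_zinbielHom] at h1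
    exact h1
  · obtain ⟨b, hb, hbm⟩ := mem_lieI_iff.1 m.2
    have hDb : D b = m := Subtype.ext (by rw [hD, dynkinProj_of_mem_lieSpan hb, hbm])
    rw [pairingForm_apply, Submodule.subtype_apply, ← hbm, hrep, hDb]

theorem pairingForm_lieI_eq_zero_iff [Algebra ℚ A] {z : NC A (Letters n)}
    (hz : z ∈ zinbielSpan (Set.range (aGen A (n := n)))) :
    pairingForm (lieI A n).toSubmodule.subtype z = 0 ↔
      z ∈ Submodule.span A {s | ∃ p ∈ zinbielSpan (Set.range (aGen A (n := n))),
        ∃ q ∈ zinbielSpan (Set.range (aGen A (n := n))), s = shuffle p q} := by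
  constructor
  · intro h
    rw [zinbielSpan_aGen] at hz ⊢
    obtain ⟨ζ, hζ, rfl⟩ := hz
    have hsq : ζ ∈ shuffleSquare A (Gen n) := by
      refine mem_shuffleSquare_of_forall_pairing_eq_zero hζ fun a ha => ?_
      rw [← pairing_zinbielHom_evalHom]
      exact LinearMap.congr_fun h ⟨_, mem_lieI_iff.2 ⟨a, ha, rfl⟩⟩
    have hmap := Submodule.mem_map_of_mem (f := zinbielHom (revGen A)) hsq
    rw [shuffleSquare, Submodule.map_span] at hmap
    refine Submodule.span_mono ?_ hmap
    rintro _ ⟨_, ⟨P, Q, hP, hQ, rfl⟩, rfl⟩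
    exact ⟨_, ⟨P, hP, rfl⟩, _, ⟨Q, hQ, rfl⟩, zinbielHom_shuffle _ P Q⟩
  · intro h
    refine LinearMap.ext fun m => ?_
    rw [pairingForm_apply, LinearMap.zero_apply]
    clear hz
    induction h using Submodule.span_induction with
    | mem s hs =>
      obtain ⟨p, hp, q, hq, rfl⟩ := hs
      exact pairing_shuffle_of_mem_lieSpan (lieI_le_freeLie m.2)
        (constTerm_of_mem_zinbielSpan_aGen hp) (constTerm_of_mem_zinbielSpan_aGen hq)
    | zero => simp
    | add P Q _ _ hP hQ => simp only [map_add, LinearMap.add_apply, hP, hQ, add_zero]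
    | smul c P _ hP => simp only [map_smul, LinearMap.smul_apply, hP, smul_zero]

theorem pairing_revGen_adGen [DecidableEq (Gen n)] (g h : Gen n) :
    pairing A _ (revGen A g) (adGen A h) = if g = h then 1 else 0 := by
  classical
  have := pairing_zinbielHom_evalHom (letter A g) (letter A h)
  rw [zinbielHom_letter (constTerm_revGen g), evalHom_letter, letter, letter,
    pairing_word_word] at this
  simpa using this

theorem neg_one_pow_mul_self (k : ℕ) : (-1 : A) ^ k * (-1) ^ k = 1 := by
  rw [← mul_pow, neg_one_mul, neg_neg, one_pow]

theorem pairing_aGen_rGen [DecidableEq (Gen n)] (g h : Gen n) :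
    pairing A _ (aGen A g) (rGen A h) = if g = h then -1 else 0 := by
  rw [aGen_eq, rGen_eq, map_smul, map_smul, LinearMap.smul_apply, pairing_revGen_adGen]
  split_ifs with hgh
  · rw [hgh, smul_eq_mul, smul_eq_mul, mul_one, pow_succ, ← mul_assoc, neg_one_pow_mul_self,
      one_mul]
  · simp

/-! ### The enveloping algebra of `I_n` -/

theorem bElt_eq (l : List (Gen n)) :
    bElt A l = evalHom (fun g => UniversalEnvelopingAlgebra.ι A
      (⟨adGen A g, adGen_mem A g⟩ : lieI A n)) (word A l) := (evalHom_word _ l).symm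

theorem envMap_bElt (l : List (Gen n)) :
    envMap (lieI A n) (bElt A l) = (l.map (adGen A)).prod := by
  rw [bElt_eq, envMap_evalHom (f := adGen A) fun _ => rfl, evalHom_word]

theorem evalHom_adGen_injective :
    Function.Injective (evalHom (A := A) (adGen A (n := n))) := by
  refine (injective_iff_map_eq_zero _).2 fun P hP => ext_pairing_right fun w => ?_
  rw [← pairing_zinbielHom_evalHom, hP, map_zero, map_zero]

/-- `U(I_n)` is the free algebra on the `ad_{-v} t`: the free algebra maps onto it, and the map
of the free algebra to the polynomials is injective by duality. -/
theorem envMap_lieI_injective : Function.Injective (envMap (lieI A n)) := by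
  intro x y hxy
  have hs := evalHom_ι_surjective (L := lieI A n) (f := adGen A) rfl
    (a := fun g => ⟨adGen A g, adGen_mem A g⟩) fun _ => rfl
  obtain ⟨P, rfl⟩ := hs x
  obtain ⟨Q, rfl⟩ := hs y
  rw [envMap_evalHom (f := adGen A) fun _ => rfl,
    envMap_evalHom (f := adGen A) fun _ => rfl] at hxy
  rw [evalHom_adGen_injective hxy]

theorem range_envMap_lieI : LinearMap.range (envMap (lieI A n)).toLinearMap =
    Submodule.span A (Set.range fun l : List (Gen n) => (l.map (adGen A)).prod) := by
  rw [← range_evalHom]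
  have hs := evalHom_ι_surjective (L := lieI A n) (f := adGen A) rfl
    (a := fun g => ⟨adGen A g, adGen_mem A g⟩) fun _ => rfl
  refine le_antisymm ?_ ?_
  · rintro _ ⟨x, rfl⟩
    obtain ⟨P, rfl⟩ := hs x
    exact ⟨P, (envMap_evalHom (f := adGen A) (fun _ => rfl) P).symm⟩
  · rintro _ ⟨P, rfl⟩
    exact ⟨_, envMap_evalHom (f := adGen A) (a := fun g => ⟨adGen A g, adGen_mem A g⟩)
      (fun _ => rfl) P⟩

theorem exists_basis_bElt :
    ∃ b : Module.Basis (List (Gen n)) A (UniversalEnvelopingAlgebra A (lieI A n)),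
      ∀ l, b l = bElt A l := by
  obtain ⟨e, he⟩ := exists_basis_word A (Gen n)
  let η : NC A (Gen n) →ₗ[A] UniversalEnvelopingAlgebra A (lieI A n) :=
    (evalHom fun g => UniversalEnvelopingAlgebra.ι A
      (⟨adGen A g, adGen_mem A g⟩ : lieI A n)).toLinearMap
  have hs : Function.Surjective η := evalHom_ι_surjective (L := lieI A n) (f := adGen A) rfl
    (a := fun g => ⟨adGen A g, adGen_mem A g⟩) fun _ => rfl
  have henv : ∀ P, envMap (lieI A n) (η P) = evalHom (adGen A) P :=
    envMap_evalHom (f := adGen A) (a := fun g => ⟨adGen A g, adGen_mem A g⟩) fun _ => rfl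
  have hi : Function.Injective η := fun P Q hPQ =>
    evalHom_adGen_injective (by rw [← henv, hPQ, henv])
  refine ⟨e.map (LinearEquiv.ofBijective η ⟨hi, hs⟩), fun l => ?_⟩
  rw [Module.Basis.map_apply, he]
  exact (bElt_eq l).symm

theorem iterHalfShuffle_aGen (l : List (Gen n)) : iterHalfShuffle (l.map (aGen A)) =
    (l.map fun g => (-1 : A) ^ (g.1.length + 1)).prod • iterHalfShuffle (l.map (revGen A)) :=
  iterHalfShuffle_map_eq_smul aGen_eq l

theorem bVee_eq (l : List (Gen n)) :
    bVee A l = (-1 : A) ^ l.length • iterHalfShuffle (l.map (revGen A)) := by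
  rw [bVee, iterHalfShuffle_map_eq_smul (c := fun _ => -1) tuGen_eq, List.map_const',
    List.prod_replicate]

theorem list_prod_map_pow {G : Type*} (c : A) (d : G → ℕ) (l : List G) :
    (l.map fun g => c ^ d g).prod = c ^ (l.map d).sum := by
  induction l with
  | nil => simp
  | cons g l ih => rw [List.map_cons, List.prod_cons, ih, List.map_cons, List.sum_cons, pow_add]

theorem list_prod_mul_self {G : Type*} {c : G → A} (hc : ∀ g, c g * c g = 1) (l : List G) :
    (l.map c).prod * (l.map c).prod = 1 := by
  induction l with
  | nil => simp
  | cons g l ih =>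
    rw [List.map_cons, List.prod_cons, mul_mul_mul_comm, hc, ih, one_mul]

theorem pairing_iterHalfShuffle_aGen_prod_rGen (l : List (Gen n)) :
    pairing A (Letters n) (iterHalfShuffle (l.map (aGen A))) ((l.map (rGen A)).prod) =
      (-1) ^ l.length := by
  classical
  rw [iterHalfShuffle_aGen, list_prod_map_eq_smul rGen_eq, map_smul, map_smul,
    LinearMap.smul_apply, pairing_iterHalfShuffle_prod, if_pos rfl, smul_eq_mul, smul_eq_mul,
    mul_one, ← List.prod_map_mul]
  simp only [pow_succ, ← mul_assoc, neg_one_pow_mul_self, one_mul]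
  rw [List.map_const', List.prod_replicate]

theorem bVee_eq_foldr (l : List (Gen n)) : bVee A l =
    l.foldr (fun g R =>
      -(letter A g.2.1 * shuffle (word A (outerWord g.1.reverse)) R)) 1 := by
  induction l with
  | nil => rfl
  | cons g l ih =>
    rw [List.foldr_cons, ← ih]
    change halfShuffle (tuGen A g) (bVee A l) = _
    rw [tuGen, map_neg, LinearMap.neg_apply, letter_mul_halfShuffle]

/-! ### The enveloping algebra of the Lie polynomials -/

theorem envMap_freeLie_bijective : Function.Bijective (envMap (freeLie A n)) := by
  have hs := evalHom_ι_surjective (L := freeLie A n) (f := letter A) rfl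
    (a := fun x => ⟨letter A x, letter_mem A x⟩) fun _ => rfl
  refine ⟨fun x y hxy => ?_, fun P => ⟨evalHom (fun x => UniversalEnvelopingAlgebra.ι A
    (⟨letter A x, letter_mem A x⟩ : freeLie A n)) P, ?_⟩⟩
  · obtain ⟨P, rfl⟩ := hs x
    obtain ⟨Q, rfl⟩ := hs y
    rw [envMap_evalHom (f := letter A) fun _ => rfl, envMap_evalHom (f := letter A) fun _ => rfl,
      evalHom_letter_eq_id, evalHom_letter_eq_id] at hxy
    rw [hxy]
  · rw [envMap_evalHom (f := letter A) fun _ => rfl, evalHom_letter_eq_id]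

theorem envMap_wbElt (w : List (Outer n)) (l : List (Gen n)) :
    envMap (freeLie A n) (wbElt A w l) = word A (outerWord w) * (l.map (adGen A)).prod := by
  have h : ∀ x : freeLie A n,
      envMap (freeLie A n) (UniversalEnvelopingAlgebra.ι A x) = (x : NC A (Letters n)) :=
    fun x => UniversalEnvelopingAlgebra.lift_ι_apply A _ x
  rw [wbElt, map_mul, map_list_prod, map_list_prod, List.map_map, List.map_map]
  congr 1
  · induction w with
    | nil => rfl
    | cons x w ih =>
      change _ = word A (x.1 :: outerWord w)
      rw [List.map_cons, List.prod_cons, ih, word_cons, Function.comp_apply, h]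
  · simp only [Function.comp_def, h]

theorem exists_basis_word_mul_prod_adGen (A : Type*) [CommRing A] (n : ℕ) :
    ∃ b : Module.Basis (List (Outer n) × List (Gen n)) A (NC A (Letters n)),
      ∀ i, b i = word A (outerWord i.1) * (i.2.map (adGen A)).prod := by
  have := Classical.decEq (List (Outer n) × List (Gen n))
  have hli : LinearIndependent A fun i : List (Outer n) × List (Gen n) =>
      word A (outerWord i.1) * (i.2.map (adGen A)).prod :=
    linearIndependent_of_dual (f := fun i => pairing A _ (shuffle (word A (outerWord i.1))
      (iterHalfShuffle (i.2.map (revGen A))))) (ε := fun _ => 1) (by simp)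
      pairing_shuffle_iterHalfShuffle
  exact ⟨Module.Basis.mk hli span_word_mul_prod_adGen.ge, fun i => by rw [Module.Basis.mk_apply]⟩

/-- The linear equivalence between the enveloping algebra of the Lie polynomials and the
noncommutative polynomials. -/
def envEquivFreeLie (A : Type*) [CommRing A] (n : ℕ) :
    UniversalEnvelopingAlgebra A (freeLie A n) ≃ₗ[A] NC A (Letters n) :=
  LinearEquiv.ofBijective (envMap (freeLie A n)).toLinearMap envMap_freeLie_bijective

theorem envMap_envEquivFreeLie_symm (P : NC A (Letters n)) :
    envMap (freeLie A n) ((envEquivFreeLie A n).symm P) = P :=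
  (envEquivFreeLie A n).apply_symm_apply P

theorem exists_basis_wbElt :
    ∃ c : Module.Basis (List (Outer n) × List (Gen n)) A
      (UniversalEnvelopingAlgebra A (freeLie A n)), ∀ i, c i = wbElt A i.1 i.2 := by
  obtain ⟨b, hb⟩ := exists_basis_word_mul_prod_adGen A n
  refine ⟨b.map (envEquivFreeLie A n).symm, fun i => envMap_freeLie_bijective.1 ?_⟩
  rw [Module.Basis.map_apply, envMap_envEquivFreeLie_symm, hb, envMap_wbElt]

theorem finite_length_add_weight_lt (n N : ℕ) :
    {i : List (Outer n) × List (Gen n) |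
      i.1.length + (i.2.map fun g => g.1.length + 1).sum < N}.Finite :=
  ((List.finite_length_lt (Outer n) N).prod (finite_weight_lt n N)).subset fun _ hi =>
    ⟨lt_of_le_of_lt (Nat.le_add_right _ _) hi, lt_of_le_of_lt (Nat.le_add_left _ _) hi⟩

end

end NCPoly

/-! ### The dual bases -/

theorem mainTheorem8 (A : Type*) [CommRing A] [IsDomain A] [Algebra ℚ A] (n : ℕ) (hn : 2 ≤ n) :
    -- duality of the generators
    ((∀ g h : Gen n, (g = h → pairing A (Letters n) (aGen A g) (rGen A h) = -1) ∧
        (g ≠ h → pairing A (Letters n) (aGen A g) (rGen A h) = 0)) ∧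
      (∀ g : Gen n, adGen A g = (-1 : A) ^ g.1.length • rGen A g ∧
        tuGen A g = (-1 : A) ^ g.1.length • aGen A g) ∧
      -- `I_n`
      LinearIndependent A (fun g : Gen n => rGen A g) ∧
      lieI A n = LieSubalgebra.lieSpan A (NC A (Letters n)) (Set.range (rGen A)) ∧
      -- `I_n^∨`
      LinearIndependent A (fun g : Gen n => aGen A g) ∧
      Submodule.span A (Set.range (tuGen A (n := n))) =
        Submodule.span A (Set.range (aGen A (n := n))) ∧
      zinbielSpan (Set.range (tuGen A (n := n))) = zinbielSpan (Set.range (aGen A (n := n))) ∧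
      (∀ p ∈ zinbielSpan (Set.range (aGen A (n := n))),
        ∀ q ∈ zinbielSpan (Set.range (aGen A (n := n))),
          shuffle p q ∈ zinbielSpan (Set.range (aGen A (n := n)))) ∧
      (zinbielSpan (Set.range (aGen A (n := n)))).map
          (pairingForm (lieI A n).toSubmodule.subtype) =
        gradedDual (lieI A n).toSubmodule.subtype ∧
      (∀ z ∈ zinbielSpan (Set.range (aGen A (n := n))),
        pairingForm (lieI A n).toSubmodule.subtype z = 0 ↔
          z ∈ Submodule.span A {s | ∃ p ∈ zinbielSpan (Set.range (aGen A (n := n))),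
            ∃ q ∈ zinbielSpan (Set.range (aGen A (n := n))), s = shuffle p q})) ∧
    -- the enveloping algebra of `I_n` and its dual
    ((∀ l : List (Gen n), pairing A (Letters n) (iterHalfShuffle (l.map (aGen A)))
        ((l.map (rGen A)).prod) = (-1) ^ l.length) ∧
      Function.Injective (envMap (lieI A n)) ∧
      LinearMap.range (envMap (lieI A n)).toLinearMap =
        Submodule.span A (Set.range fun l : List (Gen n) =>
          (-1 : A) ^ (l.map fun g => g.1.length).sum • (l.map (rGen A)).prod) ∧
      Set.InjOn (pairingForm (envMap (lieI A n)).toLinearMap)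
        (Submodule.span A (Set.range fun l : List (Gen n) =>
          iterHalfShuffle (l.map (aGen A)))) ∧
      (Submodule.span A (Set.range fun l : List (Gen n) =>
          iterHalfShuffle (l.map (aGen A)))).map
          (pairingForm (envMap (lieI A n)).toLinearMap) =
        gradedDual (envMap (lieI A n)).toLinearMap ∧
      (∀ l : List (Gen n), bVee A l =
        l.foldr (fun g R =>
          -(letter A g.2.1 * shuffle (word A (outerWord g.1.reverse)) R)) 1) ∧
      ∃ (b : Module.Basis (List (Gen n)) A (UniversalEnvelopingAlgebra A (lieI A n)))
        (b' : Module.Basis (List (Gen n)) A (gradedDual (envMap (lieI A n)).toLinearMap)),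
        (∀ l, b l = bElt A l) ∧
        (∀ l, (b' l : Module.Dual A (UniversalEnvelopingAlgebra A (lieI A n))) =
          pairingForm (envMap (lieI A n)).toLinearMap (bVee A l)) ∧
        (∀ l m, (l = m → (b' l : Module.Dual A _) (b m) = (-1) ^ l.length) ∧
          (l ≠ m → (b' l : Module.Dual A _) (b m) = 0))) ∧
    -- the enveloping algebra of the Lie polynomials and its dual
    (Function.Bijective (envMap (freeLie A n)) ∧
      Function.Injective (pairingForm (envMap (freeLie A n)).toLinearMap) ∧
      LinearMap.range (pairingForm (envMap (freeLie A n)).toLinearMap) =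
        gradedDual (envMap (freeLie A n)).toLinearMap ∧
      (∃ c : Module.Basis (List (Outer n) × List (Gen n)) A
          (UniversalEnvelopingAlgebra A (freeLie A n)),
        ∀ w l, c (w, l) = wbElt A w l) ∧
      (∃ c' : Module.Basis (List (Outer n) × List (Gen n)) A
          (gradedDual (envMap (freeLie A n)).toLinearMap),
        ∀ w l, (c' (w, l) : Module.Dual A (UniversalEnvelopingAlgebra A (freeLie A n))) =
          pairingForm (envMap (freeLie A n)).toLinearMap
            (shuffle (word A (outerWord w)) (bVee A l)))) := by
  have hw : ∀ l : List (Gen n), (envMap (lieI A n)).toLinearMap (bElt A l) ∈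
      homogeneous A _ (l.map fun g => g.1.length + 1).sum := fun l => by
    rw [AlgHom.toLinearMap_apply, envMap_bElt]
    exact list_prod_mem_homogeneous adGen_mem_homogeneous l
  refine ⟨⟨?_, ?_, ?_, lieI_eq_lieSpan_rGen, ?_, ?_, ?_, ?_, map_pairingForm_zinbielSpan, ?_⟩,
    ⟨pairing_iterHalfShuffle_aGen_prod_rGen, envMap_lieI_injective, ?_, ?_, ?_, bVee_eq_foldr,
      ?_⟩, ⟨envMap_freeLie_bijective, ?_, ?_, ?_, ?_⟩⟩
  · intro g h
    have := Classical.decEq (Gen n)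
    rw [pairing_aGen_rGen]
    exact ⟨fun hgh => if_pos hgh, fun hgh => if_neg hgh⟩
  · exact fun g => ⟨adGen_eq g, tuGen_eq_aGen g⟩
  · have := Classical.decEq (Gen n)
    exact linearIndependent_of_dual (f := fun g => pairing A _ (aGen A g)) (ε := fun _ => -1)
      (by simp) pairing_aGen_rGen
  · have := Classical.decEq (Gen n)
    refine linearIndependent_of_dual (f := fun g => (pairing A _).flip (rGen A g))
      (ε := fun _ => -1) (by simp) fun g h => ?_
    rw [LinearMap.flip_apply, pairing_aGen_rGen]
    simp only [eq_comm]
  · exact le_antisymm (span_range_le tuGen_eq_aGen) (span_range_le aGen_eq_tuGen)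
  · exact le_antisymm (zinbielSpan_range_le tuGen_eq_aGen) (zinbielSpan_range_le aGen_eq_tuGen)
  · exact fun p hp q hq => shuffle_mem_zinbielSpan_aGen hp hq
  · exact fun z hz => pairingForm_lieI_eq_zero_iff hz
  · rw [range_envMap_lieI]
    congr 2
    funext l
    rw [list_prod_map_eq_smul adGen_eq, list_prod_map_pow]
  · have := Classical.decEq (List (Gen n))
    obtain ⟨b, hb⟩ := exists_basis_bElt (A := A) (n := n)
    refine injOn_pairingForm (e := b)
      (ε := fun l => (l.map fun g => (-1 : A) ^ (g.1.length + 1)).prod)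
      (list_prod_mul_self fun g => neg_one_pow_mul_self _) fun l m => ?_
    rw [hb, AlgHom.toLinearMap_apply, envMap_bElt, iterHalfShuffle_aGen, map_smul,
      LinearMap.smul_apply, pairing_iterHalfShuffle_prod]
    simp
  · have := Classical.decEq (List (Gen n))
    obtain ⟨b, hb⟩ := exists_basis_bElt (A := A) (n := n)
    refine map_pairingForm_span (e := b)
      (ε := fun l => (l.map fun g => (-1 : A) ^ (g.1.length + 1)).prod)
      (list_prod_mul_self fun g => neg_one_pow_mul_self _) (fun l m => ?_)
      (fun l => hb l ▸ hw l) (finite_weight_lt n)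
    rw [hb, AlgHom.toLinearMap_apply, envMap_bElt, iterHalfShuffle_aGen, map_smul,
      LinearMap.smul_apply, pairing_iterHalfShuffle_prod]
    simp
  · have := Classical.decEq (List (Gen n))
    obtain ⟨b, hb⟩ := exists_basis_bElt (A := A) (n := n)
    have hpair : ∀ l m : List (Gen n), pairing A _ (bVee A l)
        ((envMap (lieI A n)).toLinearMap (b m)) = if l = m then (-1) ^ l.length else 0 := by
      intro l m
      rw [hb, AlgHom.toLinearMap_apply, envMap_bElt, bVee_eq, map_smul,
        LinearMap.smul_apply, pairing_iterHalfShuffle_prod]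
      simp
    obtain ⟨b', hb'⟩ := exists_basis_gradedDual (fun l => neg_one_pow_mul_self _) hpair
      (fun l => hb l ▸ hw l) (finite_weight_lt n)
    refine ⟨b, b', hb, hb', fun l m => ?_⟩
    rw [hb', pairingForm_apply, hpair]
    exact ⟨fun h => if_pos h, fun h => if_neg h⟩
  · intro P Q hPQ
    refine ext_pairing fun w => ?_
    obtain ⟨x, hx⟩ := envMap_freeLie_bijective.2 (word A w)
    rw [← hx]
    exact LinearMap.congr_fun hPQ x
  · obtain ⟨e, he⟩ := exists_basis_word A (Letters n)
    rw [LinearMap.range_eq_map, ← span_range_word]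
    refine map_pairingForm_span (e := e.map (envEquivFreeLie A n).symm) (ε := fun _ => 1)
      (fun _ => one_mul 1) (fun u v => ?_) (d := List.length) (fun w => ?_)
      (List.finite_length_lt (Letters n))
    · rw [Module.Basis.map_apply, AlgHom.toLinearMap_apply, envMap_envEquivFreeLie_symm, he,
        pairing_word_word]
    · rw [Module.Basis.map_apply, AlgHom.toLinearMap_apply, envMap_envEquivFreeLie_symm, he]
      exact word_mem_homogeneous w
  · obtain ⟨c, hc⟩ := exists_basis_wbElt (A := A) (n := n)
    exact ⟨c, fun w l => hc (w, l)⟩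
  · have := Classical.decEq (List (Outer n) × List (Gen n))
    obtain ⟨c, hc⟩ := exists_basis_wbElt (A := A) (n := n)
    obtain ⟨c', hc'⟩ := exists_basis_gradedDual (φ := (envMap (freeLie A n)).toLinearMap) (e := c)
      (f := fun i => shuffle (word A (outerWord i.1)) (bVee A i.2))
      (ε := fun i => (-1) ^ i.2.length)
      (d := fun i => i.1.length + (i.2.map fun g => g.1.length + 1).sum)
      (fun i => neg_one_pow_mul_self _) (fun i j => by
        rw [hc, AlgHom.toLinearMap_apply, envMap_wbElt, bVee_eq, map_smul, map_smul,
          LinearMap.smul_apply, pairing_shuffle_iterHalfShuffle]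
        simp)
      (fun i => by
        rw [hc, AlgHom.toLinearMap_apply, envMap_wbElt]
        have h := mul_mem_homogeneous (word_mem_homogeneous (A := A) (outerWord i.1))
          (list_prod_mem_homogeneous adGen_mem_homogeneous i.2)
        rwa [outerWord, List.length_map] at h)
      (finite_length_add_weight_lt n)
    exact ⟨c', fun w l => hc' (w, l)⟩
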